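/- Let $K:[0,\infty)\times[0,\infty)\to[0,\infty)$ be continuous and symmetric, $K(x,y)=K(y,x)$, and homogeneous of degree one, $K(ax,ay)=aK(x,y)$ for all $a,x,y>0$. Assume that there are constants $K_0>0$ and $\alpha>0$ such that $|K(x,1)-1|\le K_0x^\alpha$ for every $x\in[0,1]$. Then there exists $\rho_*>0$ such that for every $\rho\in(0,\rho_*)$ and for $b=\frac{1+\rho}{\rho}$ there is a function $g\in C^1((0,\infty))$ with $g(x)>0$ for every $x>0$, which solves $$b\,x\,g(x)=\int_0^x\int_{x-y}^\infty\frac{K(y,z)}{z}\,g(y)\,g(z)\,\mathrm dz\,\mathrm dy\qquad\text{for every }x>0$$ (the double integral being finite), has unit mass $\int_0^\infty g(x)\,\mathrm dx=1$, and has power-law behaviour at the origin and at infinity: there are constants $c_0,c_1>0$ such that $$\lim_{x\to0^+}\frac{g(x)}{x^{-\frac1{1+\rho}}}=c_0,\qquad \lim_{x\to\infty}\frac{g(x)}{x^{-(1+\rho)}}=c_1 .$$ -/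

import Mathlib

open MeasureTheory Set Filter Topology Asymptotics

/-- The assumptions on the coagulation kernel `K`; only its values on the closed quadrant
`[0,∞) × [0,∞)` matter. -/
structure IsCoagulationKernel (K : ℝ → ℝ → ℝ) : Prop where
  continuousOn : ContinuousOn (fun p : ℝ × ℝ => K p.1 p.2) (Ici 0 ×ˢ Ici 0)
  symm : ∀ x y : ℝ, 0 ≤ x → 0 ≤ y → K x y = K y x
  nonneg : ∀ x y : ℝ, 0 ≤ x → 0 ≤ y → 0 ≤ K x y
  homogeneous : ∀ a x y : ℝ, 0 < a → 0 < x → 0 < y → K (a * x) (a * y) = a * K x y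
  near_zero : ∃ K₀ α : ℝ, 0 < K₀ ∧ 0 < α ∧ ∀ x ∈ Icc (0 : ℝ) 1, |K x 1 - 1| ≤ K₀ * x ^ α

/-- The function `g` on `(0,∞)` solves, for every `x > 0`, the self-similar equation
`b x g(x) = ∫₀ˣ ∫_{x-y}^∞ (K(y,z)/z) g(y) g(z) dz dy`, where the double integral converges
(absolutely). -/
structure IsSelfSimilarSolution (K : ℝ → ℝ → ℝ) (b : ℝ) (g : ℝ → ℝ) : Prop where
  integrableOn : ∀ x : ℝ, 0 < x →
    IntegrableOn (fun p : ℝ × ℝ => K p.1 p.2 / p.2 * g p.1 * g p.2)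
      {p : ℝ × ℝ | 0 < p.1 ∧ p.1 < x ∧ x - p.1 < p.2}
  equation : ∀ x : ℝ, 0 < x →
    b * x * g x = ∫ y in Ioo 0 x, ∫ z in Ioi (x - y), K y z / z * g y * g z

/-! Put x = e^X, y = x e^{-s}, z = x e^t and g(x) = w(log x)/x. Homogeneity turns the equation into
b w(X) = ∬ κ(s+t) w(X-s) w(X+t) over s > 0, e^{-s} + e^t > 1, where κ(u) = K(e^{-u},1) tends to 1
exponentially as u → ∞. If the kernel is replaced by the indicator of s, t > 0, the right side is
M(1-M) with M(X) = ∫_{-∞}^X w. For large b, that is small ρ, the problem is thus a perturbation of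
the logistic equation b M' = M(1-M).

Write M = sigmoid(L) with L(0) = 0 and L' = φ/b, so that b w = M(1-M) φ. Dividing the equation by
M(1-M) leaves a fixed-point problem for φ, `growthMap`, close to φ = 1. The quotient of M(1-M) at
X-s and at X grows at most like e^{2s/b}, which the correction kernel tolerates when b is large: it
is controlled by `dominatingKernel`, which pairs with functions in L¹ ∩ L^∞ (`integrable_form`).
Hence `growthMap` contracts the continuous φ with values in [1/2, 2] (`exists_fixedPoint`).
Positivity and unit mass are built into the ansatz.

Smoothness comes from the equation: differences and differences of difference quotients of w solve
linear equations whose bilinear part is small and can be absorbed (`abs_le_of_linear_equation`), so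
the quotients are uniformly Cauchy (`contDiff_density`).

For the tails, the correction kernel is compared with e^{-(s+t)} on t ≤ 0 (y close to x, z small),
whose s-integral is exactly 1. The correction is therefore w M up to an error M(1-M)
O(e^{-|X|/(2b)}), that is φ = 1 + Mφ/b + O(e^{-|X|/(2b)}) (`exists_abs_sub_le`). So φ → 1 at -∞ and
φ → b/(b-1) at +∞, exponentially fast; integrating φ/b gives w ~ c e^{X/b} and w ~ c e^{-X/(b-1)}.
Since 1/b = ρ/(1+ρ) and 1/(b-1) = ρ, these are the two power laws. -/

/-! ### The kernel in logarithmic variables. -/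

/-- A coagulation kernel of homogeneity one read in logarithmic variables,
`κ u = K (exp (-u)) 1`. -/
structure IsLogKernel (κ : ℝ → ℝ) (K₀ α : ℝ) : Prop where
  continuous : Continuous κ
  K₀_pos : 0 < K₀
  α_pos : 0 < α
  α_le_one : α ≤ 1
  nonneg : ∀ u, 0 ≤ κ u
  right : ∀ u, 0 ≤ u → |κ u - 1| ≤ K₀ * Real.exp (-(α * u))
  left : ∀ u, u ≤ 0 → |κ u - Real.exp (-u)| ≤ K₀ * Real.exp (-u) * Real.exp (α * u)

theorem IsCoagulationKernel.isLogKernel {K : ℝ → ℝ → ℝ} (hK : IsCoagulationKernel K) :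
    ∃ K₀ α : ℝ, IsLogKernel (fun u => K (Real.exp (-u)) 1) K₀ α := by
  obtain ⟨K₀, α, hK₀, hα, h⟩ := hK.near_zero
  -- Lowering the exponent to at most 1 only weakens the bound on (0, 1]; later estimates use α ≤ 1
  -- to compare exp t with exp (α t) for t ≤ 0.
  have near : ∀ x ∈ Ioc (0 : ℝ) 1, |K x 1 - 1| ≤ K₀ * x ^ (min α 1) := by
    intro x hx
    refine (h x ⟨hx.1.le, hx.2⟩).trans (mul_le_mul_of_nonneg_left ?_ hK₀.le)
    exact Real.rpow_le_rpow_of_exponent_ge hx.1 hx.2 (min_le_left _ _)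
  refine ⟨K₀, min α 1, ?_, hK₀, lt_min hα one_pos, min_le_right _ _, ?_, ?_, ?_⟩
  · refine hK.continuousOn.comp_continuous (f := fun u : ℝ => (Real.exp (-u), (1 : ℝ)))
      (by fun_prop) fun u => ⟨(Real.exp_pos _).le, zero_le_one' ℝ⟩
  · exact fun u => hK.nonneg _ _ (Real.exp_pos _).le zero_le_one
  · intro u hu
    have := near (Real.exp (-u)) ⟨Real.exp_pos _, Real.exp_le_one_iff.2 (by linarith)⟩
    rw [← Real.exp_mul] at this
    convert this using 3
    ring
  · intro u hu
    -- Symmetry and homogeneity reflect u < 0 to -u > 0, at the price of the factor exp (-u).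
    have e : K (Real.exp (-u)) 1 = Real.exp (-u) * K (Real.exp u) 1 := by
      rw [hK.symm (Real.exp u) 1 (Real.exp_pos _).le zero_le_one,
        ← hK.homogeneous _ _ _ (Real.exp_pos _) one_pos (Real.exp_pos _), ← Real.exp_add]
      simp
    have := near (Real.exp u) ⟨Real.exp_pos _, Real.exp_le_one_iff.2 hu⟩
    rw [← Real.exp_mul] at this
    rw [e, show Real.exp (-u) * K (Real.exp u) 1 - Real.exp (-u)
      = Real.exp (-u) * (K (Real.exp u) 1 - 1) by ring, abs_mul, abs_of_pos (Real.exp_pos _)]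
    calc _ ≤ Real.exp (-u) * (K₀ * Real.exp (u * min α 1)) := by gcongr
      _ = _ := by rw [mul_comm u]; ring

/-! ### The interaction domain, the correction kernel and its majorant. -/

/-- With `y = x * exp (-s)` and `z = x * exp t`, the condition `y < x < y + z`. -/
def interactionDomain : Set (ℝ × ℝ) := {p | 0 < p.1 ∧ 1 < Real.exp p.2 + Real.exp (-p.1)}

/-- The kernel in the variables `(s, t)` with its far-field part `1` on `s, t > 0` removed. -/
noncomputable def correctionKernel (κ : ℝ → ℝ) (p : ℝ × ℝ) : ℝ :=
  interactionDomain.indicator (fun p => κ (p.1 + p.2)) p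
    - (Ioi (0 : ℝ) ×ˢ Ioi (0 : ℝ)).indicator (fun _ => 1) p

/-- One term per region: decay as s → ∞; the layer s ≲ exp t, where z may be tiny and the kernel
grows like exp (-t); and the cusp t ≈ 0⁻, s large, where the kernel does not decay and only the
width 2 exp (-s) gives integrability. -/
noncomputable def dominatingKernel (β : ℝ) (p : ℝ × ℝ) : ℝ :=
  (Ioi (0 : ℝ)).indicator (fun s => Real.exp (-(β * s))) p.1
    + {p : ℝ × ℝ | 0 < p.1 ∧ p.1 < 2 * Real.exp p.2}.indicator (fun p => Real.exp (-p.2)) p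
    + {p : ℝ × ℝ | 0 < p.1 ∧ -(2 * Real.exp (-p.1)) < p.2 ∧ p.2 ≤ 0}.indicator
        (fun p => Real.exp (β * p.1)) p

theorem measurableSet_interactionDomain : MeasurableSet interactionDomain :=
  (measurableSet_lt measurable_const measurable_fst).inter
    (measurableSet_lt measurable_const
      (by fun_prop : Measurable fun p : ℝ × ℝ => Real.exp p.2 + Real.exp (-p.1)))

theorem IsLogKernel.measurable_correctionKernel {κ : ℝ → ℝ} {K₀ α : ℝ} (h : IsLogKernel κ K₀ α) :
    Measurable (correctionKernel κ) := by
  have := h.continuous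
  have hm : Measurable fun p : ℝ × ℝ => κ (p.1 + p.2) := by fun_prop
  exact (hm.indicator measurableSet_interactionDomain).sub
    (measurable_const.indicator (measurableSet_Ioi.prod measurableSet_Ioi))

theorem dominatingKernel_nonneg (β : ℝ) (p : ℝ × ℝ) : 0 ≤ dominatingKernel β p := by
  refine add_nonneg (add_nonneg ?_ ?_) ?_ <;>
    exact indicator_nonneg (fun _ _ => (Real.exp_pos _).le) _

theorem measurableSet_layer :
    MeasurableSet {p : ℝ × ℝ | 0 < p.1 ∧ p.1 < 2 * Real.exp p.2} :=
  (measurableSet_lt measurable_const measurable_fst).inter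
    (measurableSet_lt measurable_fst (by fun_prop))

theorem measurableSet_cusp :
    MeasurableSet {p : ℝ × ℝ | 0 < p.1 ∧ -(2 * Real.exp (-p.1)) < p.2 ∧ p.2 ≤ 0} :=
  (measurableSet_lt measurable_const measurable_fst).inter
    ((measurableSet_lt (by fun_prop) measurable_snd).inter
      (measurableSet_le measurable_snd measurable_const))

/-- The slice at height t has length 2 exp t, exactly cancelling the singularity exp (-t); no decay
of v as t → -∞ beyond integrability is needed. -/
theorem integrable_layer {v : ℝ → ℝ} (hv : Integrable v) :
    Integrable (fun p : ℝ × ℝ =>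
      {p : ℝ × ℝ | 0 < p.1 ∧ p.1 < 2 * Real.exp p.2}.indicator (fun p => Real.exp (-p.2)) p
        * |v p.2|) ∧
    ∫ p : ℝ × ℝ, {p : ℝ × ℝ | 0 < p.1 ∧ p.1 < 2 * Real.exp p.2}.indicator
      (fun p => Real.exp (-p.2)) p * |v p.2| = 2 * ∫ t, |v t| := by
  have slice : ∀ t : ℝ, (fun s : ℝ => {p : ℝ × ℝ | 0 < p.1 ∧ p.1 < 2 * Real.exp p.2}.indicator
      (fun p => Real.exp (-p.2)) (s, t) * |v t|)
      = (Ioo 0 (2 * Real.exp t)).indicator (fun _ => Real.exp (-t) * |v t|) := by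
    intro t
    ext s
    by_cases hs : s ∈ Ioo 0 (2 * Real.exp t)
    · rw [indicator_of_mem hs, indicator_of_mem (show (s, t) ∈ _ from hs)]
    · rw [indicator_of_notMem hs, indicator_of_notMem (show (s, t) ∉ _ from hs), zero_mul]
  have slice_int : ∀ t : ℝ, ∫ s : ℝ, {p : ℝ × ℝ | 0 < p.1 ∧ p.1 < 2 * Real.exp p.2}.indicator
      (fun p => Real.exp (-p.2)) (s, t) * |v t| = 2 * |v t| := by
    intro t
    rw [slice, integral_indicator measurableSet_Ioo, setIntegral_const]
    have : Real.exp t * Real.exp (-t) = 1 := by rw [← Real.exp_add]; simp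
    simp only [measureReal_def, Real.volume_Ioo, smul_eq_mul]
    rw [ENNReal.toReal_ofReal (by have := Real.exp_pos t; linarith)]
    linear_combination 2 * |v t| * this
  have meas : AEStronglyMeasurable (fun p : ℝ × ℝ =>
      {p : ℝ × ℝ | 0 < p.1 ∧ p.1 < 2 * Real.exp p.2}.indicator (fun p => Real.exp (-p.2)) p
        * |v p.2|) (volume.prod volume) :=
    (Measurable.indicator (by fun_prop) measurableSet_layer).aestronglyMeasurable.mul
      hv.abs.aestronglyMeasurable.comp_snd
  have int : Integrable (fun p : ℝ × ℝ =>
      {p : ℝ × ℝ | 0 < p.1 ∧ p.1 < 2 * Real.exp p.2}.indicator (fun p => Real.exp (-p.2)) p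
        * |v p.2|) (volume.prod volume) := by
    refine (integrable_prod_iff' meas).2 ⟨Eventually.of_forall fun t => ?_, ?_⟩
    · refine Integrable.congr ((integrable_indicator_iff measurableSet_Ioo).2
        (integrableOn_const measure_Ioo_lt_top.ne))
        (Eventually.of_forall fun s => (congrFun (slice t) s).symm)
    · have norm_slice : ∀ t s : ℝ, ‖{p : ℝ × ℝ | 0 < p.1 ∧ p.1 < 2 * Real.exp p.2}.indicator
          (fun p => Real.exp (-p.2)) (s, t) * |v t|‖ =
          {p : ℝ × ℝ | 0 < p.1 ∧ p.1 < 2 * Real.exp p.2}.indicator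
          (fun p => Real.exp (-p.2)) (s, t) * |v t| := fun t s =>
        Real.norm_of_nonneg (mul_nonneg (indicator_nonneg (fun _ _ => (Real.exp_pos _).le) _)
          (abs_nonneg _))
      refine Integrable.congr (hv.abs.const_mul 2) (Eventually.of_forall fun t =>
        ((integral_congr_ae (Eventually.of_forall (norm_slice t))).trans (slice_int t)).symm)
  refine ⟨int, ?_⟩
  rw [Measure.volume_eq_prod, integral_prod_symm _ int]
  simp only [slice_int]
  rw [integral_const_mul]

theorem integral_Ioi_exp_neg_mul {a : ℝ} (ha : 0 < a) :
    ∫ s in Ioi (0 : ℝ), Real.exp (-(a * s)) = 1 / a := by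
  have := integral_exp_mul_Ioi (a := -a) (by linarith) 0
  simp only [neg_mul] at this
  rw [this]; simp

theorem integrableOn_Ioi_exp_neg_mul {a : ℝ} (ha : 0 < a) :
    IntegrableOn (fun s => Real.exp (-(a * s))) (Ioi (0 : ℝ)) := by
  have := integrableOn_exp_mul_Ioi (a := -a) (by linarith) 0
  simpa only [neg_mul] using this

/-- The slice at s has length 2 exp (-s), so the total is 2 / (1 - β), and β ≤ 1/2 makes this at
most 4. -/
theorem integrable_cusp {β : ℝ} (hβ : β ≤ 1 / 2) :
    Integrable (fun p : ℝ × ℝ =>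
      {p : ℝ × ℝ | 0 < p.1 ∧ -(2 * Real.exp (-p.1)) < p.2 ∧ p.2 ≤ 0}.indicator
        (fun p => Real.exp (β * p.1)) p) ∧
    ∫ p : ℝ × ℝ, {p : ℝ × ℝ | 0 < p.1 ∧ -(2 * Real.exp (-p.1)) < p.2 ∧ p.2 ≤ 0}.indicator
        (fun p => Real.exp (β * p.1)) p ≤ 4 := by
  set C : Set (ℝ × ℝ) := {p : ℝ × ℝ | 0 < p.1 ∧ -(2 * Real.exp (-p.1)) < p.2 ∧ p.2 ≤ 0} with hC
  have slice : ∀ s : ℝ, (fun t : ℝ => C.indicator (fun p => Real.exp (β * p.1)) (s, t))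
      = (Ioc (-(2 * Real.exp (-s))) 0).indicator
        (fun _ => (Ioi (0 : ℝ)).indicator (fun s => Real.exp (β * s)) s) := by
    intro s
    ext t
    by_cases hs : 0 < s
    · by_cases ht : t ∈ Ioc (-(2 * Real.exp (-s))) 0
      · rw [indicator_of_mem ht, indicator_of_mem (show (s, t) ∈ C from ⟨hs, ht⟩),
          indicator_of_mem (show s ∈ Ioi (0 : ℝ) from hs)]
      · rw [indicator_of_notMem ht, indicator_of_notMem (show (s, t) ∉ C from fun h => ht h.2)]
    · rw [indicator_of_notMem (show (s, t) ∉ C from fun h => hs h.1),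
        indicator_of_notMem (show s ∉ Ioi (0 : ℝ) from hs)]
      simp
  have slice_int : ∀ s : ℝ, ∫ t : ℝ, C.indicator (fun p => Real.exp (β * p.1)) (s, t) =
      (Ioi (0 : ℝ)).indicator (fun s => 2 * Real.exp (-((1 - β) * s))) s := by
    intro s
    rw [slice, integral_indicator measurableSet_Ioc, setIntegral_const]
    simp only [measureReal_def, Real.volume_Ioc, smul_eq_mul]
    rw [ENNReal.toReal_ofReal (by have := Real.exp_pos (-s); linarith)]
    by_cases hs : 0 < s
    · rw [indicator_of_mem (show s ∈ Ioi (0 : ℝ) from hs),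
        indicator_of_mem (show s ∈ Ioi (0 : ℝ) from hs),
        show -((1 - β) * s) = -s + β * s by ring, Real.exp_add]
      ring
    · rw [indicator_of_notMem (show s ∉ Ioi (0 : ℝ) from hs),
        indicator_of_notMem (show s ∉ Ioi (0 : ℝ) from hs), mul_zero]
  have int : Integrable (fun p : ℝ × ℝ => C.indicator (fun p => Real.exp (β * p.1)) p)
      (volume.prod volume) := by
    refine (integrable_prod_iff
      (Measurable.indicator (by fun_prop) measurableSet_cusp).aestronglyMeasurable).2
      ⟨Eventually.of_forall fun s => ?_, ?_⟩
    · refine Integrable.congr ((integrable_indicator_iff measurableSet_Ioc).2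
        (integrableOn_const measure_Ioc_lt_top.ne))
        (Eventually.of_forall fun t => (congrFun (slice s) t).symm)
    · have : ∀ s t : ℝ, ‖C.indicator (fun p => Real.exp (β * p.1)) (s, t)‖ =
          C.indicator (fun p => Real.exp (β * p.1)) (s, t) := fun s t =>
        Real.norm_of_nonneg (indicator_nonneg (fun _ _ => (Real.exp_pos _).le) _)
      refine Integrable.congr ?_ (Eventually.of_forall fun s =>
        ((integral_congr_ae (Eventually.of_forall (this s))).trans (slice_int s)).symm)
      exact (integrable_indicator_iff measurableSet_Ioi).2
        ((integrableOn_Ioi_exp_neg_mul (by linarith)).const_mul 2)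
  refine ⟨int, ?_⟩
  rw [Measure.volume_eq_prod, integral_prod _ int]
  simp only [slice_int]
  rw [integral_indicator measurableSet_Ioi, integral_const_mul,
    integral_Ioi_exp_neg_mul (by linarith)]
  rw [mul_one_div, div_le_iff₀ (by linarith)]
  linarith

/-- The basic estimate on the dominating kernel. -/
theorem integrable_dominatingKernel_mul {β : ℝ} (hβ : 0 < β) (hβ' : β ≤ 1 / 2) {v : ℝ → ℝ} {V : ℝ}
    (hv : Integrable v) (hV : ∀ t, |v t| ≤ V) (hV' : ∫ t, |v t| ≤ V) :
    Integrable (fun p : ℝ × ℝ => dominatingKernel β p * |v p.2|) ∧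
      ∫ p : ℝ × ℝ, dominatingKernel β p * |v p.2| ≤ (1 / β + 6) * V := by
  have i₁ : Integrable (fun p : ℝ × ℝ =>
      (Ioi (0 : ℝ)).indicator (fun s => Real.exp (-(β * s))) p.1 * |v p.2|) :=
    ((integrable_indicator_iff measurableSet_Ioi).2
      (integrableOn_Ioi_exp_neg_mul hβ)).mul_prod hv.abs
  have e₁ : ∫ p : ℝ × ℝ, (Ioi (0 : ℝ)).indicator (fun s => Real.exp (-(β * s))) p.1 * |v p.2|
      = 1 / β * ∫ t, |v t| := by
    rw [Measure.volume_eq_prod, integral_prod_mul (fun s => (Ioi (0 : ℝ)).indicator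
      (fun s => Real.exp (-(β * s))) s) (fun t => |v t|), integral_indicator measurableSet_Ioi,
      integral_Ioi_exp_neg_mul hβ]
  obtain ⟨i₂, e₂⟩ := integrable_layer hv
  obtain ⟨i₃, e₃⟩ := integrable_cusp hβ'
  have V0 : 0 ≤ V := (abs_nonneg _).trans (hV 0)
  -- The cusp is thin in t, so here v enters through its supremum; the other two terms use its L¹
  -- norm.
  have i₄ : Integrable (fun p : ℝ × ℝ =>
      {p : ℝ × ℝ | 0 < p.1 ∧ -(2 * Real.exp (-p.1)) < p.2 ∧ p.2 ≤ 0}.indicator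
        (fun p => Real.exp (β * p.1)) p * |v p.2|) := by
    refine (i₃.mul_const V).mono (i₃.aestronglyMeasurable.mul
      (hv.abs.aestronglyMeasurable.comp_snd)) (Eventually.of_forall fun p => ?_)
    rw [norm_mul, norm_mul, Real.norm_eq_abs |v p.2|, abs_abs, Real.norm_of_nonneg V0]
    exact mul_le_mul_of_nonneg_left (hV _) (norm_nonneg _)
  have e₄ : ∫ p : ℝ × ℝ,
      {p : ℝ × ℝ | 0 < p.1 ∧ -(2 * Real.exp (-p.1)) < p.2 ∧ p.2 ≤ 0}.indicator
        (fun p => Real.exp (β * p.1)) p * |v p.2| ≤ 4 * V := by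
    refine (integral_mono i₄ (i₃.mul_const V) fun p => ?_).trans ?_
    · exact mul_le_mul_of_nonneg_left (hV _) (indicator_nonneg (fun _ _ => (Real.exp_pos _).le) _)
    · rw [integral_mul_const]
      exact mul_le_mul_of_nonneg_right e₃ V0
  have split : (fun p : ℝ × ℝ => dominatingKernel β p * |v p.2|) = fun p : ℝ × ℝ =>
      ((Ioi (0 : ℝ)).indicator (fun s => Real.exp (-(β * s))) p.1 * |v p.2| +
      {p : ℝ × ℝ | 0 < p.1 ∧ p.1 < 2 * Real.exp p.2}.indicator (fun p => Real.exp (-p.2)) p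
        * |v p.2|) + {p : ℝ × ℝ | 0 < p.1 ∧ -(2 * Real.exp (-p.1)) < p.2 ∧ p.2 ≤ 0}.indicator
        (fun p => Real.exp (β * p.1)) p * |v p.2| := by
    ext p
    simp only [dominatingKernel]
    ring
  have i₁₂ : Integrable (fun p : ℝ × ℝ =>
      (Ioi (0 : ℝ)).indicator (fun s => Real.exp (-(β * s))) p.1 * |v p.2| +
      {p : ℝ × ℝ | 0 < p.1 ∧ p.1 < 2 * Real.exp p.2}.indicator (fun p => Real.exp (-p.2)) p
        * |v p.2|) := i₁.add i₂
  rw [split]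
  refine ⟨i₁₂.add i₄, ?_⟩
  rw [integral_add i₁₂ i₄, integral_add i₁ i₂, e₁, e₂]
  have : 1 / β * ∫ t, |v t| ≤ 1 / β * V := by gcongr
  linarith

/-! ### Pointwise and integral bounds for the correction kernel. -/

/-- Split at exp (-s) = 1/2. Above it, (1 + s) exp (-s) ≤ 1 gives s exp (-s) < exp t: the layer.
Below it, with v = exp (-s), t ≤ -2v would give exp t ≤ 1 / (1 + 2v) ≤ 1 - v, contradicting
membership: the cusp. -/
theorem interactionDomain_cases {p : ℝ × ℝ} (hp : p ∈ interactionDomain) (ht : p.2 ≤ 0) :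
    (p.1 ≤ 1 ∧ p.1 < 2 * Real.exp p.2) ∨ (-(2 * Real.exp (-p.1)) < p.2 ∧ 0 < p.1 + p.2) := by
  obtain ⟨s, t⟩ := p
  obtain ⟨hs, hd⟩ := hp
  simp only at hs hd ht ⊢
  by_cases hv : 1 / 2 ≤ Real.exp (-s)
  · left
    have h1 : (1 + s) * Real.exp (-s) ≤ 1 := by
      calc (1 + s) * Real.exp (-s) ≤ Real.exp s * Real.exp (-s) := by
            gcongr; linarith [Real.add_one_le_exp s]
        _ = 1 := by rw [← Real.exp_add]; simp
    have h2 : s ≤ 1 := by nlinarith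
    exact ⟨h2, by nlinarith⟩
  · right
    push Not at hv
    constructor
    · by_contra hc
      push Not at hc
      set v := Real.exp (-s) with hv'
      have v0 : 0 < v := Real.exp_pos _
      have h1 : (1 + 2 * v) * Real.exp (-(2 * v)) ≤ 1 := by
        calc (1 + 2 * v) * Real.exp (-(2 * v)) ≤ Real.exp (2 * v) * Real.exp (-(2 * v)) := by
              gcongr; linarith [Real.add_one_le_exp (2 * v)]
          _ = 1 := by rw [← Real.exp_add]; simp
      have h2 : Real.exp t ≤ Real.exp (-(2 * v)) := Real.exp_le_exp.2 hc
      nlinarith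
    · have : Real.exp (-s) < Real.exp t := by linarith
      linarith [Real.exp_lt_exp.1 this]

theorem exp_one_le_three : Real.exp 1 ≤ 3 := by linarith [Real.exp_one_lt_d9]

/-- The constant in the estimates of integrals against the dominating kernel. -/
noncomputable def formConst (K₀ α : ℝ) : ℝ := 2 * (1 + K₀) * (2 / α + 6)

namespace IsLogKernel

variable {κ : ℝ → ℝ} {K₀ α : ℝ}

theorem le_of_nonneg (h : IsLogKernel κ K₀ α) {u : ℝ} (hu : 0 ≤ u) : κ u ≤ 1 + K₀ := by
  have h1 := (abs_le.1 (h.right u hu)).2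
  have h2 : Real.exp (-(α * u)) ≤ 1 := Real.exp_le_one_iff.2 (by nlinarith [h.α_pos])
  nlinarith [h.K₀_pos]

theorem le_of_nonpos (h : IsLogKernel κ K₀ α) {u : ℝ} (hu : u ≤ 0) :
    κ u ≤ (1 + K₀) * Real.exp (-u) := by
  have h1 := (abs_le.1 (h.left u hu)).2
  have h2 : Real.exp (α * u) ≤ 1 := Real.exp_le_one_iff.2 (by nlinarith [h.α_pos])
  have h3 : K₀ * Real.exp (-u) * Real.exp (α * u) ≤ K₀ * Real.exp (-u) * 1 := by
    have := h.K₀_pos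
    gcongr
  linarith

theorem le_exp_neg (h : IsLogKernel κ K₀ α) {s t : ℝ} (hs : 0 ≤ s) (ht : t ≤ 0) :
    κ (s + t) ≤ (1 + K₀) * Real.exp (-t) := by
  have := h.K₀_pos
  rcases le_total 0 (s + t) with hu | hu
  · refine (h.le_of_nonneg hu).trans ?_
    have : 1 ≤ Real.exp (-t) := Real.one_le_exp (by linarith)
    nlinarith
  · refine (h.le_of_nonpos hu).trans ?_
    gcongr
    linarith

theorem dominatingKernel_layer (β : ℝ) {p : ℝ × ℝ} (h0 : 0 < p.1) (h : p.1 < 2 * Real.exp p.2) :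
    Real.exp (-p.2) ≤ dominatingKernel β p := by
  have h1 : 0 ≤ (Ioi (0 : ℝ)).indicator (fun s => Real.exp (-(β * s))) p.1 :=
    indicator_nonneg (fun _ _ => (Real.exp_pos _).le) _
  have h3 : 0 ≤ {p : ℝ × ℝ | 0 < p.1 ∧ -(2 * Real.exp (-p.1)) < p.2 ∧ p.2 ≤ 0}.indicator
        (fun p => Real.exp (β * p.1)) p :=
    indicator_nonneg (fun _ _ => (Real.exp_pos _).le) _
  rw [dominatingKernel, indicator_of_mem (show p ∈ {p : ℝ × ℝ | 0 < p.1 ∧ p.1 < 2 * Real.exp p.2}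
    from ⟨h0, h⟩)]
  linarith

theorem dominatingKernel_cusp (β : ℝ) {p : ℝ × ℝ} (h0 : 0 < p.1)
    (h : -(2 * Real.exp (-p.1)) < p.2) (h' : p.2 ≤ 0) :
    Real.exp (β * p.1) ≤ dominatingKernel β p := by
  have h1 : 0 ≤ (Ioi (0 : ℝ)).indicator (fun s => Real.exp (-(β * s))) p.1 :=
    indicator_nonneg (fun _ _ => (Real.exp_pos _).le) _
  have h3 : 0 ≤ {p : ℝ × ℝ | 0 < p.1 ∧ p.1 < 2 * Real.exp p.2}.indicator
        (fun p => Real.exp (-p.2)) p :=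
    indicator_nonneg (fun _ _ => (Real.exp_pos _).le) _
  rw [dominatingKernel, indicator_of_mem (show p ∈ {p : ℝ × ℝ | 0 < p.1 ∧
    -(2 * Real.exp (-p.1)) < p.2 ∧ p.2 ≤ 0} from ⟨h0, h, h'⟩)]
  linarith

theorem dominatingKernel_far (β : ℝ) {p : ℝ × ℝ} (h0 : 0 < p.1) :
    Real.exp (-(β * p.1)) ≤ dominatingKernel β p := by
  have h1 : 0 ≤ {p : ℝ × ℝ | 0 < p.1 ∧ p.1 < 2 * Real.exp p.2}.indicator
        (fun p => Real.exp (-p.2)) p :=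
    indicator_nonneg (fun _ _ => (Real.exp_pos _).le) _
  have h3 : 0 ≤ {p : ℝ × ℝ | 0 < p.1 ∧ -(2 * Real.exp (-p.1)) < p.2 ∧ p.2 ≤ 0}.indicator
        (fun p => Real.exp (β * p.1)) p :=
    indicator_nonneg (fun _ _ => (Real.exp_pos _).le) _
  rw [dominatingKernel, indicator_of_mem (show p.1 ∈ Ioi (0 : ℝ) from h0)]
  linarith

theorem correctionKernel_of_pos (κ : ℝ → ℝ) {p : ℝ × ℝ} (hs : 0 < p.1) (ht : 0 < p.2) :
    correctionKernel κ p = κ (p.1 + p.2) - 1 := by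
  have : p ∈ interactionDomain :=
    ⟨hs, by linarith [Real.one_lt_exp_iff.2 ht, Real.exp_pos (-p.1)]⟩
  rw [correctionKernel, indicator_of_mem this,
    indicator_of_mem (show p ∈ Ioi (0 : ℝ) ×ˢ Ioi (0 : ℝ) from ⟨hs, ht⟩)]

theorem correctionKernel_of_nonpos (κ : ℝ → ℝ) {p : ℝ × ℝ} (hp : p ∈ interactionDomain)
    (ht : p.2 ≤ 0) : correctionKernel κ p = κ (p.1 + p.2) := by
  rw [correctionKernel, indicator_of_mem hp, indicator_of_notMem
    (show p ∉ Ioi (0 : ℝ) ×ˢ Ioi (0 : ℝ) from fun h => absurd h.2 (not_lt.2 ht)), sub_zero]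

theorem correctionKernel_of_notMem (κ : ℝ → ℝ) {p : ℝ × ℝ} (hp : p ∉ interactionDomain)
    (h : p.2 ≤ 0 ∨ p.1 ≤ 0) : correctionKernel κ p = 0 := by
  rw [correctionKernel, indicator_of_notMem hp, indicator_of_notMem, sub_zero]
  rintro ⟨h1, h2⟩
  rcases h with h | h
  · exact absurd h2 (not_lt.2 h)
  · exact absurd h1 (not_lt.2 h)

/-- The weight exp (α s / 2) leaves room for first factors that grow as s → ∞. For t > 0, half of
the decay exp (-α s) of κ - 1 pays for it; in the layer s ≤ 1 and the weight is harmless; in the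
cusp κ is bounded and the weight is part of the majorant. -/
theorem abs_correctionKernel_le (h : IsLogKernel κ K₀ α) (p : ℝ × ℝ) :
    |correctionKernel κ p| * Real.exp (α / 2 * p.1)
      ≤ 2 * (1 + K₀) * dominatingKernel (α / 2) p := by
  have hK := h.K₀_pos
  have hα := h.α_pos
  have hα1 := h.α_le_one
  have dn := dominatingKernel_nonneg (α / 2) p
  rcases le_or_gt p.1 0 with hs | hs
  · rw [correctionKernel_of_notMem κ (fun hp => absurd hp.1 (not_lt.2 hs)) (Or.inr hs), abs_zero,
      zero_mul]
    positivity
  rcases lt_or_ge 0 p.2 with ht | ht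
  · rw [correctionKernel_of_pos κ hs ht]
    have h1 := h.right (p.1 + p.2) (by positivity)
    have h2 : Real.exp (-(α * (p.1 + p.2))) * Real.exp (α / 2 * p.1)
        ≤ Real.exp (-(α / 2 * p.1)) := by
      rw [← Real.exp_add]
      exact Real.exp_le_exp.2 (by nlinarith)
    calc _ ≤ K₀ * Real.exp (-(α * (p.1 + p.2))) * Real.exp (α / 2 * p.1) := by gcongr
      _ ≤ K₀ * dominatingKernel (α / 2) p := by
        rw [mul_assoc]; gcongr; exact h2.trans (dominatingKernel_far _ hs)
      _ ≤ _ := by nlinarith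
  by_cases hp : p ∈ interactionDomain
  swap
  · rw [correctionKernel_of_notMem κ hp (Or.inl ht), abs_zero, zero_mul]
    positivity
  rw [correctionKernel_of_nonpos κ hp ht, abs_of_nonneg (h.nonneg _)]
  rcases interactionDomain_cases hp ht with ⟨h1, h2⟩ | ⟨h1, h2⟩
  · have e2 : Real.exp (α / 2 * p.1) ≤ 2 := by
      calc _ ≤ Real.exp (1 / 2) := Real.exp_le_exp.2 (by nlinarith)
        _ ≤ 2 := by
          have : Real.exp (1 / 2) * Real.exp (1 / 2) = Real.exp 1 := by
            rw [← Real.exp_add]; norm_num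
          nlinarith [exp_one_le_three, Real.exp_pos (1 / 2)]
    calc _ ≤ ((1 + K₀) * Real.exp (-p.2)) * 2 := by
          gcongr
          exact h.le_exp_neg hs.le ht
      _ ≤ ((1 + K₀) * dominatingKernel (α / 2) p) * 2 := by
          gcongr; exact dominatingKernel_layer _ hs h2
      _ = _ := by ring
  · calc _ ≤ (1 + K₀) * dominatingKernel (α / 2) p := by
          gcongr
          · exact h.le_of_nonneg h2.le
          · exact dominatingKernel_cusp _ hs h1 ht
      _ ≤ _ := by nlinarith

/-- Near the diagonal the correction kernel acts like `exp (-(s + t))` on `t ≤ 0`, up to terms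
that decay in `t`. -/
theorem abs_correctionKernel_mul_sub_le (h : IsLogKernel κ K₀ α) {u : ℝ → ℝ} {u₀ A : ℝ}
    (hu : ∀ s, 0 < s → |u s| ≤ A * Real.exp (α / 2 * s)) (hu₀ : |u₀| ≤ A)
    (hlip : ∀ s, 0 < s → s ≤ 1 → |u s - u₀| ≤ A * s) (p : ℝ × ℝ) :
    |correctionKernel κ p * u p.1 - (interactionDomain ∩ {p | p.2 ≤ 0}).indicator
        (fun p => Real.exp (-(p.1 + p.2))) p * u₀|
      ≤ 14 * (1 + K₀) * A * dominatingKernel (α / 2) p * Real.exp (-(α * |p.2|)) := by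
  have hK := h.K₀_pos
  have hα := h.α_pos
  have hα1 := h.α_le_one
  have hA : 0 ≤ A := (abs_nonneg _).trans hu₀
  have dn := dominatingKernel_nonneg (α / 2) p
  rcases le_or_gt p.1 0 with hs | hs
  · rw [correctionKernel_of_notMem κ (fun hp => absurd hp.1 (not_lt.2 hs)) (Or.inr hs),
      indicator_of_notMem (fun hp => absurd hp.1.1 (not_lt.2 hs))]
    simp only [zero_mul, sub_zero, abs_zero]
    positivity
  rcases lt_or_ge 0 p.2 with ht | ht
  · rw [correctionKernel_of_pos κ hs ht, indicator_of_notMem (fun hp => absurd hp.2 (not_le.2 ht)),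
      zero_mul, sub_zero, abs_mul, abs_of_pos ht]
    have h1 := h.right (p.1 + p.2) (by positivity)
    calc _ ≤ (K₀ * Real.exp (-(α * (p.1 + p.2)))) * (A * Real.exp (α / 2 * p.1)) := by
          gcongr; exact hu _ hs
      _ = K₀ * A * Real.exp (-(α / 2 * p.1)) * Real.exp (-(α * p.2)) := by
          have : Real.exp (-(α * (p.1 + p.2))) * Real.exp (α / 2 * p.1)
              = Real.exp (-(α / 2 * p.1)) * Real.exp (-(α * p.2)) := by
            rw [← Real.exp_add, ← Real.exp_add]; ring_nf
          linear_combination K₀ * A * this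
      _ ≤ (14 * (1 + K₀)) * A * dominatingKernel (α / 2) p * Real.exp (-(α * p.2)) := by
          gcongr
          · linarith
          · exact dominatingKernel_far _ hs
  by_cases hp : p ∈ interactionDomain
  swap
  · rw [correctionKernel_of_notMem κ hp (Or.inl ht), indicator_of_notMem (fun h => hp h.1)]
    simp only [zero_mul, sub_zero, abs_zero]
    positivity
  rw [correctionKernel_of_nonpos κ hp ht, indicator_of_mem
    (show p ∈ interactionDomain ∩ {p | p.2 ≤ 0} from ⟨hp, ht⟩), abs_of_nonpos ht]
  obtain ⟨s, t⟩ := p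
  simp only at hs ht dn ⊢
  have et : -(α * -t) = α * t := by ring
  rw [et]
  -- For bounded t the decay factor exp (α t) is free: it is at least exp (-1) ≥ 1/3, since α ≤ 1.
  have third : ∀ r : ℝ, -1 ≤ r → 1 ≤ 3 * Real.exp (α * r) := by
    intro r hr
    have h1 : Real.exp (-1) ≤ Real.exp (α * r) := Real.exp_le_exp.2 (by nlinarith)
    have h2 : Real.exp 1 * Real.exp (-1) = 1 := by rw [← Real.exp_add]; simp
    nlinarith [exp_one_le_three, Real.exp_pos (-1)]
  rcases interactionDomain_cases hp ht with ⟨h1, h2⟩ | ⟨h1, h2⟩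
  · simp only at h1 h2
    have us : |u s| ≤ 2 * A := by
      refine (hu s hs).trans ?_
      rw [mul_comm]
      gcongr
      calc _ ≤ Real.exp (1 / 2) := Real.exp_le_exp.2 (by nlinarith)
        _ ≤ 2 := by
          have : Real.exp (1 / 2) * Real.exp (1 / 2) = Real.exp 1 := by
            rw [← Real.exp_add]; norm_num
          nlinarith [exp_one_le_three, Real.exp_pos (1 / 2)]
    have kd : |κ (s + t) - Real.exp (-(s + t))|
        ≤ 3 * (2 + K₀) * Real.exp (-t) * Real.exp (α * t) := by
      rcases le_total (s + t) 0 with hu | hu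
      · refine (h.left _ hu).trans ?_
        have e1 : Real.exp (-(s + t)) ≤ Real.exp (-t) := Real.exp_le_exp.2 (by linarith)
        have e2 : Real.exp (α * (s + t)) ≤ 3 * Real.exp (α * t) := by
          rw [mul_add, Real.exp_add]
          gcongr
          exact (Real.exp_le_exp.2 (by nlinarith)).trans exp_one_le_three
        calc _ ≤ K₀ * Real.exp (-t) * (3 * Real.exp (α * t)) := by gcongr
          _ = 3 * K₀ * Real.exp (-t) * Real.exp (α * t) := by ring
          _ ≤ _ := by gcongr; linarith
      · have e1 := third t (by linarith)
        have e2 : 1 ≤ Real.exp (-t) := Real.one_le_exp (by linarith)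
        have e3 : |κ (s + t) - Real.exp (-(s + t))| ≤ 2 + K₀ := by
          have := h.le_of_nonneg hu
          have := h.nonneg (s + t)
          have : Real.exp (-(s + t)) ≤ 1 := Real.exp_le_one_iff.2 (by linarith)
          have := Real.exp_pos (-(s + t))
          rw [abs_le]
          constructor <;> linarith
        calc _ ≤ (2 + K₀) * 1 * 1 := by linarith
          _ ≤ (2 + K₀) * Real.exp (-t) * (3 * Real.exp (α * t)) := by gcongr
          _ = _ := by ring
    -- The width of the layer turns the Lipschitz error A s of freezing u at u₀ into decay in t.
    have sl : s ≤ 2 * Real.exp (α * t) :=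
      h2.le.trans (mul_le_mul_of_nonneg_left (Real.exp_le_exp.2 (by nlinarith)) (by norm_num))
    calc |κ (s + t) * u s - Real.exp (-(s + t)) * u₀|
        = |(κ (s + t) - Real.exp (-(s + t))) * u s + Real.exp (-(s + t)) * (u s - u₀)| := by
          ring_nf
      _ ≤ |κ (s + t) - Real.exp (-(s + t))| * |u s| + Real.exp (-(s + t)) * |u s - u₀| := by
          refine (abs_add_le _ _).trans ?_
          rw [abs_mul, abs_mul, abs_of_pos (Real.exp_pos _)]
      _ ≤ (3 * (2 + K₀) * Real.exp (-t) * Real.exp (α * t)) * (2 * A)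
          + Real.exp (-t) * (A * (2 * Real.exp (α * t))) := by
          gcongr
          · linarith
          · exact (hlip s hs h1).trans (by gcongr)
      _ = (14 + 6 * K₀) * A * Real.exp (-t) * Real.exp (α * t) := by ring
      _ ≤ _ := by
          gcongr
          · linarith
          · exact dominatingKernel_layer (α / 2) (p := (s, t)) hs h2
  · simp only at h1 h2
    have t1 : -1 ≤ t := by
      have : Real.exp (-s) < Real.exp t := Real.exp_lt_exp.2 (by linarith)
      rcases le_total (1 / 2) (Real.exp (-s)) with h3 | h3
      · have : Real.exp (-1) < Real.exp t := by
          have : Real.exp (-1) < 1 / 2 := by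
            have h2 : Real.exp 1 * Real.exp (-1) = 1 := by rw [← Real.exp_add]; simp
            nlinarith [Real.exp_one_gt_d9, Real.exp_pos (-1)]
          linarith
        exact (Real.exp_lt_exp.1 this).le
      · linarith
    have e1 := third t t1
    have e2 : 1 ≤ Real.exp (α / 2 * s) := Real.one_le_exp (by positivity)
    have e3 : Real.exp (-(s + t)) ≤ 1 := Real.exp_le_one_iff.2 (by linarith)
    calc |κ (s + t) * u s - Real.exp (-(s + t)) * u₀|
        ≤ κ (s + t) * |u s| + Real.exp (-(s + t)) * |u₀| := by
          refine (abs_sub _ _).trans ?_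
          rw [abs_mul, abs_mul, abs_of_pos (Real.exp_pos _), abs_of_nonneg (h.nonneg _)]
      _ ≤ (1 + K₀) * (A * Real.exp (α / 2 * s)) + 1 * (A * Real.exp (α / 2 * s)) := by
          gcongr
          · exact h.le_of_nonneg h2.le
          · exact hu s hs
          · nlinarith
      _ = (2 + K₀) * A * Real.exp (α / 2 * s) * 1 := by ring
      _ ≤ (2 + K₀) * A * dominatingKernel (α / 2) (s, t) * (3 * Real.exp (α * t)) := by
          gcongr
          exact dominatingKernel_cusp (α / 2) (p := (s, t)) hs h1 ht
      _ = (3 * (2 + K₀)) * A * dominatingKernel (α / 2) (s, t) * Real.exp (α * t) := by ring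
      _ ≤ _ := by
          gcongr ?_ * A * _ * _
          linarith

theorem integrable_of_le_dominatingKernel (h : IsLogKernel κ K₀ α) {f : ℝ × ℝ → ℝ} {v : ℝ → ℝ}
    {C V : ℝ} (hf : AEStronglyMeasurable f volume) (hC : 0 ≤ C) (hv : Integrable v)
    (hV : ∀ t, |v t| ≤ V) (hV' : ∫ t, |v t| ≤ V)
    (hle : ∀ p, |f p| ≤ C * (dominatingKernel (α / 2) p * |v p.2|)) :
    Integrable f ∧ |∫ p, f p| ≤ C * ((2 / α + 6) * V) := by
  obtain ⟨i, e⟩ := integrable_dominatingKernel_mul (β := α / 2) (by linarith [h.α_pos])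
    (by linarith [h.α_le_one]) hv hV hV'
  rw [one_div_div] at e
  refine ⟨(i.const_mul C).mono' hf (Eventually.of_forall hle), ?_⟩
  calc |∫ p, f p| ≤ ∫ p, C * (dominatingKernel (α / 2) p * |v p.2|) :=
        norm_integral_le_of_norm_le (f := f) (i.const_mul C) (Eventually.of_forall hle)
    _ = C * ∫ p, dominatingKernel (α / 2) p * |v p.2| := integral_const_mul _ _
    _ ≤ _ := by gcongr

/-- The bilinear estimate behind everything that follows: the first factor may grow like exp (α s /
2), while V bounds both the supremum and the L¹ norm of the second. -/
theorem integrable_form (h : IsLogKernel κ K₀ α) {u v : ℝ → ℝ} {A V : ℝ} (hu : Measurable u)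
    (hA : ∀ s, 0 < s → |u s| ≤ A * Real.exp (α / 2 * s)) (hv : Integrable v)
    (hV : ∀ t, |v t| ≤ V) (hV' : ∫ t, |v t| ≤ V) :
    Integrable (fun p : ℝ × ℝ => correctionKernel κ p * u p.1 * v p.2) ∧
      |∫ p : ℝ × ℝ, correctionKernel κ p * u p.1 * v p.2| ≤ formConst K₀ α * A * V := by
  have hA0 : 0 ≤ A := by
    by_contra hc
    have := (abs_nonneg _).trans (hA 1 one_pos)
    nlinarith [Real.exp_pos (α / 2 * 1)]
  have hK := h.K₀_pos
  have key : ∀ p : ℝ × ℝ,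
      |correctionKernel κ p| * |u p.1| ≤ 2 * (1 + K₀) * A * dominatingKernel (α / 2) p := by
    intro p
    rcases le_or_gt p.1 0 with hs | hs
    · rw [correctionKernel_of_notMem κ (fun hp => absurd hp.1 (not_lt.2 hs)) (Or.inr hs),
        abs_zero, zero_mul]
      have := dominatingKernel_nonneg (α / 2) p
      positivity
    · calc _ ≤ |correctionKernel κ p| * (A * Real.exp (α / 2 * p.1)) := by
            gcongr; exact hA _ hs
        _ = A * (|correctionKernel κ p| * Real.exp (α / 2 * p.1)) := by ring
        _ ≤ A * (2 * (1 + K₀) * dominatingKernel (α / 2) p) := by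
            gcongr ?_ * ?_; exact h.abs_correctionKernel_le p
        _ = _ := by ring
  have hle : ∀ p : ℝ × ℝ, |correctionKernel κ p * u p.1 * v p.2|
      ≤ 2 * (1 + K₀) * A * (dominatingKernel (α / 2) p * |v p.2|) := by
    intro p
    rw [abs_mul, abs_mul]
    calc _ ≤ (2 * (1 + K₀) * A * dominatingKernel (α / 2) p) * |v p.2| := by
          gcongr ?_ * _; exact key p
      _ = _ := by ring
  obtain ⟨i, e⟩ := h.integrable_of_le_dominatingKernel
    ((h.measurable_correctionKernel.mul (hu.comp measurable_fst)).aestronglyMeasurable.mul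
      hv.aestronglyMeasurable.comp_snd) (by positivity) hv hV hV' hle
  exact ⟨i, e.trans_eq (by rw [formConst]; ring)⟩

end IsLogKernel

/-! ### Growth rates, the logistic ansatz and its two-sided bounds. -/

theorem integral_exp_neg_mul_abs {c : ℝ} (hc : 0 < c) :
    ∫ x : ℝ, Real.exp (-(c * |x|)) = 2 / c := by
  rw [integral_comp_abs (f := fun x => Real.exp (-(c * x))), integral_Ioi_exp_neg_mul hc]
  ring

theorem integrable_exp_neg_mul_abs {c : ℝ} (hc : 0 < c) :
    Integrable fun x : ℝ => Real.exp (-(c * |x|)) := by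
  by_contra h
  have := integral_exp_neg_mul_abs hc
  rw [integral_undef h] at this
  have : 0 < 2 / c := by positivity
  linarith

/-- Admissible (normalised) logarithmic growth rates. -/
structure IsGrowthRate (φ : ℝ → ℝ) : Prop where
  continuous : Continuous φ
  lower : ∀ X, 1 / 2 ≤ φ X
  upper : ∀ X, φ X ≤ 2

/-- The base point 0 fixes the translation freedom of the equation by placing half of the mass on
each side of X = 0. -/
noncomputable def logit (b : ℝ) (φ : ℝ → ℝ) (X : ℝ) : ℝ := (∫ u in (0 : ℝ)..X, φ u) / b

/-- The cumulative mass in logarithmic variables. -/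
noncomputable def mass (b : ℝ) (φ : ℝ → ℝ) (X : ℝ) : ℝ := Real.sigmoid (logit b φ X)

/-- The far-field part of the interaction integral, and the weight in which all later pointwise
bounds are measured. -/
noncomputable def bump (b : ℝ) (φ : ℝ → ℝ) (X : ℝ) : ℝ := mass b φ X * (1 - mass b φ X)

/-- The derivative of the cumulative mass. -/
noncomputable def density (b : ℝ) (φ : ℝ → ℝ) (X : ℝ) : ℝ := bump b φ X * φ X / b

/-- The quotient `bump (X - s) / bump X` in terms of the exponentiated increment `E` of the logit
and of `M = mass X`. -/
noncomputable def bumpRatio (E M : ℝ) : ℝ := E / (E * (1 - M) + M) ^ 2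

theorem Real.sigmoid_mul_one_sub_le (x : ℝ) :
    Real.sigmoid x * (1 - Real.sigmoid x) ≤ Real.exp (-|x|) := by
  have key : ∀ y : ℝ, Real.sigmoid y ≤ Real.exp y := by
    intro y
    rw [Real.sigmoid_def]
    calc (1 + Real.exp (-y))⁻¹ ≤ (Real.exp (-y))⁻¹ := by gcongr; linarith
      _ = Real.exp y := by rw [← Real.exp_neg, neg_neg]
  have h0 := Real.sigmoid_pos x
  have h1 := Real.sigmoid_lt_one x
  rcases le_total 0 x with hx | hx
  · rw [abs_of_nonneg hx]
    have := key (-x)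
    rw [Real.sigmoid_neg] at this
    nlinarith [Real.exp_pos (-x)]
  · rw [abs_of_nonpos hx, neg_neg]
    have := key x
    nlinarith [Real.exp_pos x]

theorem Real.sigmoid_mul_one_sub_sub (x D : ℝ) :
    Real.sigmoid (x - D) * (1 - Real.sigmoid (x - D))
      = Real.sigmoid x * (1 - Real.sigmoid x) * bumpRatio (Real.exp D) (Real.sigmoid x) := by
  have e1 : Real.exp (-(x - D)) = Real.exp (-x) * Real.exp D := by
    rw [← Real.exp_add]; ring_nf
  rw [bumpRatio, Real.sigmoid_def, Real.sigmoid_def, e1]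
  have hz := Real.exp_pos (-x)
  have hE := Real.exp_pos D
  set z := Real.exp (-x)
  set E := Real.exp D
  have h1 : (1 : ℝ) + z ≠ 0 := by positivity
  have h2 : (1 : ℝ) + z * E ≠ 0 := by positivity
  have h3 : E * (1 - (1 + z)⁻¹) + (1 + z)⁻¹ = (1 + z * E) / (1 + z) := by
    field_simp
    ring
  rw [h3]
  field_simp
  ring

theorem bumpRatio_denom {E M : ℝ} (hE : 1 ≤ E) (h0 : 0 ≤ M) (h1 : M ≤ 1) :
    1 ≤ E * (1 - M) + M ∧ E * (1 - M) + M ≤ E := by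
  constructor <;> nlinarith

theorem bumpRatio_pos {E M : ℝ} (hE : 1 ≤ E) (h0 : 0 ≤ M) (h1 : M ≤ 1) : 0 < bumpRatio E M := by
  have := (bumpRatio_denom hE h0 h1).1
  rw [bumpRatio]
  positivity

theorem bumpRatio_le {E M : ℝ} (hE : 1 ≤ E) (h0 : 0 ≤ M) (h1 : M ≤ 1) : bumpRatio E M ≤ E := by
  have := (bumpRatio_denom hE h0 h1).1
  rw [bumpRatio]
  exact div_le_self (by linarith) (one_le_pow₀ this)

theorem inv_le_bumpRatio {E M : ℝ} (hE : 1 ≤ E) (h0 : 0 ≤ M) (h1 : M ≤ 1) :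
    E⁻¹ ≤ bumpRatio E M := by
  obtain ⟨h2, h3⟩ := bumpRatio_denom hE h0 h1
  rw [bumpRatio, inv_eq_one_div, div_le_div_iff₀ (by linarith) (by positivity), one_mul, ← sq]
  gcongr

/-- Both denominators are at least 1, so no smallness of M or 1 - M enters: the bound is uniform in
X, as the contraction in the supremum norm requires. -/
theorem abs_bumpRatio_sub_le {E₁ E₂ M₁ M₂ E : ℝ} (hE₁ : 1 ≤ E₁) (hE₂ : 1 ≤ E₂) (hE₁' : E₁ ≤ E)
    (hE₂' : E₂ ≤ E) (h0 : 0 ≤ M₁) (h1 : M₁ ≤ 1) (h0' : 0 ≤ M₂) (h1' : M₂ ≤ 1) :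
    |bumpRatio E₁ M₁ - bumpRatio E₂ M₂| ≤ |E₁ - E₂| * (1 + 2 * E) + 2 * E ^ 2 * |M₁ - M₂| := by
  obtain ⟨a1, b1⟩ := bumpRatio_denom hE₁ h0 h1
  obtain ⟨a2, b2⟩ := bumpRatio_denom hE₂ h0' h1'
  rw [bumpRatio, bumpRatio]
  have hA : |(E₁ * (1 - M₁) + M₁) - (E₂ * (1 - M₂) + M₂)| ≤ |E₁ - E₂| + E * |M₁ - M₂| := by
    have : (E₁ * (1 - M₁) + M₁) - (E₂ * (1 - M₂) + M₂)
        = (1 - M₁) * (E₁ - E₂) + (1 - E₂) * (M₁ - M₂) := by ring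
    rw [this]
    refine (abs_add_le _ _).trans ?_
    rw [abs_mul, abs_mul, abs_of_nonneg (by linarith : 0 ≤ 1 - M₁),
      abs_of_nonpos (by linarith : 1 - E₂ ≤ 0)]
    have := abs_nonneg (E₁ - E₂)
    have := abs_nonneg (M₁ - M₂)
    gcongr
    · nlinarith
    · linarith
  set A₁ := E₁ * (1 - M₁) + M₁
  set A₂ := E₂ * (1 - M₂) + M₂
  have p1 : 0 < A₁ := by linarith
  have p2 : 0 < A₂ := by linarith
  have split : E₁ / A₁ ^ 2 - E₂ / A₂ ^ 2
      = (E₁ - E₂) * (1 / A₁ ^ 2) + E₂ * ((A₂ - A₁) * (1 / (A₁ * A₂ ^ 2) + 1 / (A₁ ^ 2 * A₂))) := by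
    field_simp
    ring
  have q1 : 1 / A₁ ^ 2 ≤ 1 := by
    rw [div_le_one (by positivity)]; exact one_le_pow₀ a1
  have q2 : 1 / (A₁ * A₂ ^ 2) ≤ 1 := by
    rw [div_le_one (by positivity)]; nlinarith [one_le_pow₀ a2 (n := 2)]
  have q3 : 1 / (A₁ ^ 2 * A₂) ≤ 1 := by
    rw [div_le_one (by positivity)]; nlinarith [one_le_pow₀ a1 (n := 2)]
  rw [split]
  refine (abs_add_le _ _).trans ?_
  rw [abs_mul, abs_mul, abs_mul, abs_of_pos (by positivity : 0 < 1 / A₁ ^ 2),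
    abs_of_pos (by linarith : 0 < E₂),
    abs_of_pos (by positivity : 0 < 1 / (A₁ * A₂ ^ 2) + 1 / (A₁ ^ 2 * A₂)), abs_sub_comm A₂ A₁]
  have E0 : 0 ≤ E := by linarith
  calc _ ≤ |E₁ - E₂| * 1 + E * ((|E₁ - E₂| + E * |M₁ - M₂|) * (1 + 1)) := by gcongr
    _ = _ := by ring

namespace IsGrowthRate

variable {φ φ₁ φ₂ : ℝ → ℝ} {b d : ℝ}

theorem pos (h : IsGrowthRate φ) (X : ℝ) : 0 < φ X := by linarith [h.lower X]

theorem hasDerivAt_logit (h : IsGrowthRate φ) (X : ℝ) : HasDerivAt (logit b φ) (φ X / b) X :=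
  (intervalIntegral.integral_hasDerivAt_right (h.continuous.intervalIntegrable _ _)
    (h.continuous.stronglyMeasurableAtFilter _ _) h.continuous.continuousAt).div_const b

theorem continuous_logit (h : IsGrowthRate φ) : Continuous (logit b φ) :=
  continuous_iff_continuousAt.2 fun X => (h.hasDerivAt_logit X).continuousAt

theorem hasDerivAt_mass (h : IsGrowthRate φ) (X : ℝ) :
    HasDerivAt (mass b φ) (density b φ X) X := by
  refine ((Real.hasDerivAt_sigmoid (logit b φ X)).comp X (h.hasDerivAt_logit X)).congr_deriv ?_
  simp only [density, bump, mass]; ring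

theorem continuous_mass (h : IsGrowthRate φ) : Continuous (mass b φ) :=
  continuous_sigmoid.comp h.continuous_logit

theorem continuous_bump (h : IsGrowthRate φ) : Continuous (bump b φ) :=
  h.continuous_mass.mul (continuous_const.sub h.continuous_mass)

theorem continuous_density (h : IsGrowthRate φ) : Continuous (density b φ) :=
  (h.continuous_bump.mul h.continuous).div_const b

end IsGrowthRate

theorem mass_pos (b : ℝ) (φ : ℝ → ℝ) (X : ℝ) : 0 < mass b φ X := Real.sigmoid_pos _

theorem mass_lt_one (b : ℝ) (φ : ℝ → ℝ) (X : ℝ) : mass b φ X < 1 := Real.sigmoid_lt_one _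

theorem bump_pos (b : ℝ) (φ : ℝ → ℝ) (X : ℝ) : 0 < bump b φ X :=
  mul_pos (mass_pos _ _ _) (sub_pos.2 (mass_lt_one _ _ _))

theorem bump_le_quarter (b : ℝ) (φ : ℝ → ℝ) (X : ℝ) : bump b φ X ≤ 1 / 4 := by
  rw [bump]; nlinarith [sq_nonneg (mass b φ X - 1 / 2)]

theorem logit_zero (b : ℝ) (φ : ℝ → ℝ) : logit b φ 0 = 0 := by simp [logit]

theorem bump_eq_mul_bumpRatio (b : ℝ) (φ : ℝ → ℝ) (X Y : ℝ) :
    bump b φ Y = bump b φ X * bumpRatio (Real.exp (logit b φ X - logit b φ Y)) (mass b φ X) := by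
  have := Real.sigmoid_mul_one_sub_sub (logit b φ X) (logit b φ X - logit b φ Y)
  rwa [sub_sub_cancel] at this

namespace IsGrowthRate

variable {φ φ₁ φ₂ : ℝ → ℝ} {b d : ℝ}

theorem logit_sub (h : IsGrowthRate φ) (X Y : ℝ) :
    logit b φ Y - logit b φ X = (∫ u in X..Y, φ u) / b := by
  rw [logit, logit, ← sub_div, intervalIntegral.integral_interval_sub_left] <;>
    exact h.continuous.intervalIntegrable _ _

theorem logit_sub_le (h : IsGrowthRate φ) (hb : 0 < b) {X Y : ℝ} (hXY : X ≤ Y) :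
    logit b φ Y - logit b φ X ≤ 2 * (Y - X) / b := by
  rw [h.logit_sub]
  gcongr
  have := intervalIntegral.integral_mono_on (μ := volume) hXY
    (h.continuous.intervalIntegrable X Y) (continuous_const.intervalIntegrable X Y) (fun u _ => h.upper u)
  rw [intervalIntegral.integral_const, smul_eq_mul] at this
  linarith

theorem le_logit_sub (h : IsGrowthRate φ) (hb : 0 < b) {X Y : ℝ} (hXY : X ≤ Y) :
    (Y - X) / (2 * b) ≤ logit b φ Y - logit b φ X := by
  rw [h.logit_sub, ← div_div]
  gcongr
  have := intervalIntegral.integral_mono_on (μ := volume) hXY (continuous_const.intervalIntegrable X Y)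
    (h.continuous.intervalIntegrable X Y) (fun u _ => h.lower u)
  rw [intervalIntegral.integral_const, smul_eq_mul] at this
  linarith

theorem abs_logit_ge (h : IsGrowthRate φ) (hb : 0 < b) (X : ℝ) :
    |X| / (2 * b) ≤ |logit b φ X| := by
  rcases le_total 0 X with hX | hX
  · have := h.le_logit_sub hb hX
    rw [logit_zero, sub_zero, sub_zero] at this
    rw [abs_of_nonneg hX]
    exact this.trans (le_abs_self _)
  · have := h.le_logit_sub hb hX
    rw [logit_zero, zero_sub, zero_sub] at this
    rw [abs_of_nonpos hX]
    exact this.trans (neg_le_abs _)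

theorem bump_le_exp (h : IsGrowthRate φ) (hb : 0 < b) (X : ℝ) :
    bump b φ X ≤ Real.exp (-(1 / (2 * b) * |X|)) := by
  refine (Real.sigmoid_mul_one_sub_le _).trans (Real.exp_le_exp.2 (neg_le_neg ?_))
  have := h.abs_logit_ge hb X
  rwa [div_eq_inv_mul, ← one_div] at this

theorem one_le_exp_logit_sub (h : IsGrowthRate φ) (hb : 0 < b) {X Y : ℝ} (hXY : X ≤ Y) :
    1 ≤ Real.exp (logit b φ Y - logit b φ X) := by
  refine Real.one_le_exp (le_trans ?_ (h.le_logit_sub hb hXY))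
  have : 0 ≤ Y - X := sub_nonneg.2 hXY
  positivity

theorem exp_logit_sub_le (h : IsGrowthRate φ) (hb : 0 < b) {X Y : ℝ} (hXY : X ≤ Y) :
    Real.exp (logit b φ Y - logit b φ X) ≤ Real.exp (2 * (Y - X) / b) :=
  Real.exp_le_exp.2 (h.logit_sub_le hb hXY)

/-- A Harnack inequality: the logit has slope at most 2/b, and `bumpRatio E M` lies between E⁻¹ and
E. -/
theorem bump_le_mul_bump (h : IsGrowthRate φ) (hb : 0 < b) (X Y : ℝ) :
    bump b φ Y ≤ Real.exp (2 * |Y - X| / b) * bump b φ X := by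
  rcases le_total Y X with hXY | hXY
  · rw [bump_eq_mul_bumpRatio b φ X Y, mul_comm, abs_sub_comm, abs_of_nonneg (sub_nonneg.2 hXY)]
    refine mul_le_mul_of_nonneg_right ?_ (bump_pos _ _ _).le
    exact (bumpRatio_le (h.one_le_exp_logit_sub hb hXY) (mass_pos _ _ _).le
      (mass_lt_one _ _ _).le).trans (h.exp_logit_sub_le hb hXY)
  · rw [bump_eq_mul_bumpRatio b φ Y X, abs_of_nonneg (sub_nonneg.2 hXY)]
    have h1 := inv_le_bumpRatio (h.one_le_exp_logit_sub hb hXY) (mass_pos b φ Y).le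
      (mass_lt_one b φ Y).le
    have h2 : (Real.exp (2 * (Y - X) / b))⁻¹ ≤ (Real.exp (logit b φ Y - logit b φ X))⁻¹ := by
      have := h.exp_logit_sub_le hb hXY
      gcongr
    have h3 := Real.exp_pos (2 * (Y - X) / b)
    calc bump b φ Y = Real.exp (2 * (Y - X) / b) *
          (bump b φ Y * (Real.exp (2 * (Y - X) / b))⁻¹) := by field_simp
      _ ≤ _ := by
        have := (bump_pos b φ Y).le
        gcongr
        exact h2.trans h1

theorem density_pos (h : IsGrowthRate φ) (hb : 0 < b) (X : ℝ) : 0 < density b φ X :=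
  div_pos (mul_pos (bump_pos _ _ _) (h.pos X)) hb

theorem density_le (h : IsGrowthRate φ) (hb : 0 < b) (X : ℝ) :
    density b φ X ≤ 2 / b * bump b φ X := by
  rw [density]
  calc _ ≤ bump b φ X * 2 / b := by
        have := (bump_pos b φ X).le
        have := h.upper X
        gcongr
    _ = _ := by ring

theorem bump_le_density (h : IsGrowthRate φ) (hb : 0 < b) (X : ℝ) :
    bump b φ X ≤ 2 * b * density b φ X := by
  rw [density]
  have h1 := (bump_pos b φ X).le
  have h2 := h.lower X
  field_simp
  nlinarith

theorem density_le_exp (h : IsGrowthRate φ) (hb : 0 < b) (X : ℝ) :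
    density b φ X ≤ 2 / b * Real.exp (-(1 / (2 * b) * |X|)) :=
  (h.density_le hb X).trans (mul_le_mul_of_nonneg_left (h.bump_le_exp hb X) (by positivity))

theorem density_le_one (h : IsGrowthRate φ) (hb : 1 ≤ b) (X : ℝ) : density b φ X ≤ 1 := by
  refine (h.density_le (by linarith) X).trans ?_
  have h1 := bump_le_quarter b φ X
  have h2 : 2 / b ≤ 2 := by rw [div_le_iff₀ (by linarith)]; linarith
  nlinarith [bump_pos b φ X]

theorem integrable_density (h : IsGrowthRate φ) (hb : 0 < b) : Integrable (density b φ) := by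
  refine ((integrable_exp_neg_mul_abs (c := 1 / (2 * b)) (by positivity)).const_mul (2 / b)).mono'
    h.continuous_density.aestronglyMeasurable (Eventually.of_forall fun X => ?_)
  rw [Real.norm_of_nonneg (h.density_pos hb X).le]
  exact h.density_le_exp hb X

theorem tendsto_logit_atTop (h : IsGrowthRate φ) (hb : 0 < b) :
    Tendsto (logit b φ) atTop atTop := by
  refine tendsto_atTop_mono' _ ?_ (tendsto_id.atTop_div_const (by positivity : 0 < 2 * b))
  filter_upwards [eventually_ge_atTop 0] with X hX
  have := h.le_logit_sub hb hX
  simpa [logit_zero] using this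

theorem tendsto_logit_atBot (h : IsGrowthRate φ) (hb : 0 < b) :
    Tendsto (logit b φ) atBot atBot := by
  refine tendsto_atBot_mono' _ ?_ (tendsto_id.atBot_div_const (by positivity : 0 < 2 * b))
  filter_upwards [eventually_le_atBot 0] with X hX
  have := h.le_logit_sub hb hX
  rw [logit_zero, zero_sub, zero_sub, neg_div] at this
  simpa using this

theorem tendsto_mass_atTop (h : IsGrowthRate φ) (hb : 0 < b) :
    Tendsto (mass b φ) atTop (𝓝 1) :=
  Real.tendsto_sigmoid_atTop.comp (h.tendsto_logit_atTop hb)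

theorem tendsto_mass_atBot (h : IsGrowthRate φ) (hb : 0 < b) :
    Tendsto (mass b φ) atBot (𝓝 0) :=
  Real.tendsto_sigmoid_atBot.comp (h.tendsto_logit_atBot hb)

theorem integral_density (h : IsGrowthRate φ) (hb : 0 < b) : ∫ X, density b φ X = 1 := by
  rw [integral_of_hasDerivAt_of_tendsto h.hasDerivAt_mass (h.integrable_density hb)
    (h.tendsto_mass_atBot hb) (h.tendsto_mass_atTop hb), sub_zero]

theorem integral_Iic_density (h : IsGrowthRate φ) (hb : 0 < b) (X : ℝ) :
    ∫ u in Iic X, density b φ u = mass b φ X := by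
  rw [integral_Iic_of_hasDerivAt_of_tendsto' (fun x _ => h.hasDerivAt_mass x)
    (h.integrable_density hb).integrableOn (h.tendsto_mass_atBot hb), sub_zero]

theorem integral_Ioi_density (h : IsGrowthRate φ) (hb : 0 < b) (X : ℝ) :
    ∫ u in Ioi X, density b φ u = 1 - mass b φ X :=
  integral_Ioi_of_hasDerivAt_of_tendsto' (fun x _ => h.hasDerivAt_mass x)
    (h.integrable_density hb).integrableOn (h.tendsto_mass_atTop hb)

theorem integrable_bump (h : IsGrowthRate φ) (hb : 0 < b) : Integrable (bump b φ) := by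
  refine ((h.integrable_density hb).const_mul (2 * b)).mono'
    h.continuous_bump.aestronglyMeasurable (Eventually.of_forall fun X => ?_)
  rw [Real.norm_of_nonneg (bump_pos _ _ _).le]
  exact h.bump_le_density hb X

theorem integral_bump_le (h : IsGrowthRate φ) (hb : 0 < b) : ∫ X, bump b φ X ≤ 2 * b := by
  refine (integral_mono (h.integrable_bump hb) ((h.integrable_density hb).const_mul (2 * b))
    (h.bump_le_density hb)).trans_eq ?_
  rw [integral_const_mul, h.integral_density hb, mul_one]

/-! Dependence on the growth rate. -/

theorem abs_logit_sub_logit_sub_le (h₁ : IsGrowthRate φ₁) (h₂ : IsGrowthRate φ₂) (hb : 0 < b)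
    (hd : ∀ X, |φ₁ X - φ₂ X| ≤ d) (X Y : ℝ) :
    |(logit b φ₁ Y - logit b φ₁ X) - (logit b φ₂ Y - logit b φ₂ X)| ≤ d * |Y - X| / b := by
  rw [h₁.logit_sub, h₂.logit_sub, ← sub_div, ← intervalIntegral.integral_sub
    (h₁.continuous.intervalIntegrable _ _) (h₂.continuous.intervalIntegrable _ _), abs_div,
    abs_of_pos hb]
  gcongr
  exact intervalIntegral.norm_integral_le_of_norm_le_const
    (f := fun u => φ₁ u - φ₂ u) fun u _ => hd u

end IsGrowthRate

theorem Real.abs_sigmoid_sub_le_of_le {x y r : ℝ} (hx : r ≤ x) (hy : r ≤ y) :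
    |Real.sigmoid x - Real.sigmoid y| ≤ Real.exp (-r) * |x - y| := by
  have bound : ∀ u ∈ Ici r, ‖Real.sigmoid u * (1 - Real.sigmoid u)‖ ≤ Real.exp (-r) := by
    intro u hu
    rw [Real.norm_of_nonneg (mul_nonneg (Real.sigmoid_nonneg _)
      (sub_nonneg.2 (Real.sigmoid_le_one _)))]
    refine (Real.sigmoid_mul_one_sub_le u).trans (Real.exp_le_exp.2 (neg_le_neg ?_))
    exact le_trans hu (le_abs_self u)
  have := (convex_Ici r).norm_image_sub_le_of_norm_hasDerivWithin_le
    (fun u _ => (Real.hasDerivAt_sigmoid u).hasDerivWithinAt) bound hy hx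
  simpa only [Real.norm_eq_abs] using this

theorem Real.abs_sigmoid_sub_le {x y r : ℝ}
    (h : (r ≤ x ∧ r ≤ y) ∨ (x ≤ -r ∧ y ≤ -r)) :
    |Real.sigmoid x - Real.sigmoid y| ≤ Real.exp (-r) * |x - y| := by
  rcases h with ⟨hx, hy⟩ | ⟨hx, hy⟩
  · exact Real.abs_sigmoid_sub_le_of_le hx hy
  · have := Real.abs_sigmoid_sub_le_of_le (le_neg.1 hx) (le_neg.1 hy)
    rw [Real.sigmoid_neg, Real.sigmoid_neg] at this
    rw [abs_sub_comm, abs_sub_comm x y]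
    convert this using 2 <;> ring_nf

namespace IsGrowthRate

variable {φ φ₁ φ₂ : ℝ → ℝ} {b d : ℝ}

/-- The logits differ by at most d|X|/b, and both lie beyond |X|/(2b) on the same side of 0, where
the sigmoid has slope at most exp (-|X|/(2b)). Half of this exponential absorbs the linear factor.
-/
theorem abs_mass_sub_le (h₁ : IsGrowthRate φ₁) (h₂ : IsGrowthRate φ₂) (hb : 0 < b)
    (hd : ∀ X, |φ₁ X - φ₂ X| ≤ d) (X : ℝ) :
    |mass b φ₁ X - mass b φ₂ X| ≤ 4 * d * Real.exp (-(1 / (4 * b) * |X|)) := by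
  have d0 : 0 ≤ d := (abs_nonneg _).trans (hd 0)
  have hL := h₁.abs_logit_sub_logit_sub_le h₂ hb hd 0 X
  simp only [logit_zero, sub_zero] at hL
  have h3 : |mass b φ₁ X - mass b φ₂ X| ≤
      Real.exp (-(|X| / (2 * b))) * |logit b φ₁ X - logit b φ₂ X| := by
    refine Real.abs_sigmoid_sub_le ?_
    rcases le_total 0 X with hX | hX
    · left
      rw [abs_of_nonneg hX]
      have a1 := h₁.le_logit_sub hb hX
      have a2 := h₂.le_logit_sub hb hX
      simp only [logit_zero, sub_zero] at a1 a2
      exact ⟨a1, a2⟩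
    · right
      rw [abs_of_nonpos hX]
      have a1 := h₁.le_logit_sub hb hX
      have a2 := h₂.le_logit_sub hb hX
      simp only [logit_zero, zero_sub] at a1 a2
      exact ⟨le_neg.2 a1, le_neg.2 a2⟩
  set y := 1 / (4 * b) * |X| with hy
  have e1 : |X| / (2 * b) = y + y := by rw [hy]; field_simp; ring
  have e2 : d * |X| / b = 4 * d * y := by rw [hy]; field_simp
  have y0 : 0 ≤ y := by positivity
  rw [e1] at h3
  rw [e2] at hL
  have e3 : y * Real.exp (-y) ≤ 1 := by
    calc y * Real.exp (-y) ≤ Real.exp y * Real.exp (-y) := by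
          gcongr; linarith [Real.add_one_le_exp y]
      _ = 1 := by rw [← Real.exp_add]; simp
  calc _ ≤ Real.exp (-(y + y)) * (4 * d * y) := h3.trans (by gcongr)
    _ = 4 * d * Real.exp (-y) * (y * Real.exp (-y)) := by rw [neg_add, Real.exp_add]; ring
    _ ≤ 4 * d * Real.exp (-y) * 1 := by gcongr
    _ = _ := mul_one _

theorem abs_density_sub_le (h₁ : IsGrowthRate φ₁) (h₂ : IsGrowthRate φ₂) (hb : 0 < b)
    (hd : ∀ X, |φ₁ X - φ₂ X| ≤ d) (X : ℝ) :
    |density b φ₁ X - density b φ₂ X| ≤ 9 * d / b * Real.exp (-(1 / (4 * b) * |X|)) := by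
  have d0 : 0 ≤ d := (abs_nonneg _).trans (hd 0)
  have hM := h₁.abs_mass_sub_le h₂ hb hd X
  have hm : |bump b φ₁ X - bump b φ₂ X| ≤ 4 * d * Real.exp (-(1 / (4 * b) * |X|)) := by
    have : bump b φ₁ X - bump b φ₂ X
        = (mass b φ₁ X - mass b φ₂ X) * (1 - mass b φ₁ X - mass b φ₂ X) := by
      rw [bump, bump]; ring
    rw [this, abs_mul]
    refine (mul_le_of_le_one_right (abs_nonneg _) ?_).trans hM
    rw [abs_le]
    constructor <;> linarith [mass_pos b φ₁ X, mass_pos b φ₂ X, mass_lt_one b φ₁ X,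
      mass_lt_one b φ₂ X]
  have hm1 : bump b φ₁ X ≤ Real.exp (-(1 / (4 * b) * |X|)) := by
    refine (h₁.bump_le_exp hb X).trans (Real.exp_le_exp.2 (neg_le_neg ?_))
    gcongr
    norm_num
  have split : density b φ₁ X - density b φ₂ X
      = (bump b φ₁ X * (φ₁ X - φ₂ X) + (bump b φ₁ X - bump b φ₂ X) * φ₂ X) / b := by
    rw [density, density]; ring
  rw [split, abs_div, abs_of_pos hb]
  have := h₂.upper X
  have := (h₂.pos X).le
  have := (bump_pos b φ₁ X).le
  calc _ ≤ (Real.exp (-(1 / (4 * b) * |X|)) * d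
        + (4 * d * Real.exp (-(1 / (4 * b) * |X|))) * 2) / b := by
        gcongr
        refine (abs_add_le _ _).trans ?_
        rw [abs_mul, abs_mul, abs_of_pos (bump_pos b φ₁ X), abs_of_pos (h₂.pos X)]
        gcongr
        exact hd X
    _ = _ := by ring

theorem integral_abs_density_sub_le (h₁ : IsGrowthRate φ₁) (h₂ : IsGrowthRate φ₂) (hb : 0 < b)
    (hd : ∀ X, |φ₁ X - φ₂ X| ≤ d) :
    ∫ X, |density b φ₁ X - density b φ₂ X| ≤ 72 * d := by
  refine (integral_mono ((h₁.integrable_density hb).sub (h₂.integrable_density hb)).abs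
    ((integrable_exp_neg_mul_abs (c := 1 / (4 * b)) (by positivity)).const_mul (9 * d / b))
    (h₁.abs_density_sub_le h₂ hb hd)).trans_eq ?_
  rw [integral_const_mul, integral_exp_neg_mul_abs (by positivity)]
  field_simp
  ring

theorem abs_density_sub_le' (h₁ : IsGrowthRate φ₁) (h₂ : IsGrowthRate φ₂) (hb : 1 ≤ b)
    (hd : ∀ X, |φ₁ X - φ₂ X| ≤ d) (X : ℝ) :
    |density b φ₁ X - density b φ₂ X| ≤ 72 * d := by
  have d0 : 0 ≤ d := (abs_nonneg _).trans (hd 0)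
  refine (h₁.abs_density_sub_le h₂ (by linarith) hd X).trans ?_
  have e1 : Real.exp (-(1 / (4 * b) * |X|)) ≤ 1 :=
    Real.exp_le_one_iff.2 (neg_nonpos.2 (by positivity))
  have e2 : 9 * d / b ≤ 9 * d := div_le_self (by positivity) hb
  calc _ ≤ 9 * d * 1 := by gcongr
    _ ≤ _ := by linarith

theorem abs_bumpRatio_logit_sub_le (h₁ : IsGrowthRate φ₁) (h₂ : IsGrowthRate φ₂) (hb : 0 < b)
    (hd : ∀ X, |φ₁ X - φ₂ X| ≤ d) (X : ℝ) {s : ℝ} (hs : 0 ≤ s) :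
    |bumpRatio (Real.exp (logit b φ₁ X - logit b φ₁ (X - s))) (mass b φ₁ X)
      - bumpRatio (Real.exp (logit b φ₂ X - logit b φ₂ (X - s))) (mass b φ₂ X)|
      ≤ 11 * d * Real.exp (5 * s / b) := by
  have d0 : 0 ≤ d := (abs_nonneg _).trans (hd 0)
  have hle : X - s ≤ X := by linarith
  have hM : |mass b φ₁ X - mass b φ₂ X| ≤ 4 * d := by
    refine (h₁.abs_mass_sub_le h₂ hb hd X).trans (mul_le_of_le_one_right (by positivity) ?_)
    exact Real.exp_le_one_iff.2 (neg_nonpos.2 (by positivity))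
  have a1 := h₁.one_le_exp_logit_sub hb hle
  have a2 := h₂.one_le_exp_logit_sub hb hle
  have b1 := h₁.exp_logit_sub_le hb hle
  have b2 := h₂.exp_logit_sub_le hb hle
  rw [sub_sub_cancel] at b1 b2
  have hD := h₁.abs_logit_sub_logit_sub_le h₂ hb hd (X - s) X
  rw [sub_sub_cancel, abs_of_nonneg hs] at hD
  have hE : |Real.exp (logit b φ₁ X - logit b φ₁ (X - s))
      - Real.exp (logit b φ₂ X - logit b φ₂ (X - s))| ≤ Real.exp (2 * s / b) * (d * s / b) := by
    have := (convex_Iic (2 * s / b)).norm_image_sub_le_of_norm_hasDerivWithin_le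
      (f := Real.exp) (f' := Real.exp) (C := Real.exp (2 * s / b))
      (fun u _ => (Real.hasDerivAt_exp u).hasDerivWithinAt)
      (fun u hu => by rw [Real.norm_of_nonneg (Real.exp_pos _).le]; exact Real.exp_le_exp.2 hu)
      (Real.exp_le_exp.1 b2) (Real.exp_le_exp.1 b1)
    simp only [Real.norm_eq_abs] at this
    exact this.trans (by gcongr)
  have hR := abs_bumpRatio_sub_le a1 a2 b1 b2 (mass_pos b φ₁ X).le (mass_lt_one b φ₁ X).le
    (mass_pos b φ₂ X).le (mass_lt_one b φ₂ X).le
  set x := s / b with hx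
  have x0 : 0 ≤ x := by positivity
  rw [mul_div_assoc] at hR hE
  rw [mul_div_assoc, ← hx] at hE
  rw [← hx] at hR
  rw [mul_div_assoc, ← hx]
  set E := Real.exp (2 * x) with hEdef
  have E1 : 1 ≤ E := Real.one_le_exp (by positivity)
  -- The Lipschitz bound for `bumpRatio` costs E² = exp (4x); one more exp x absorbs the factor 3x +
  -- 8. This is the origin of the exponent 5s/b.
  have e5 : Real.exp (5 * x) = E * E * Real.exp x := by
    rw [hEdef, ← Real.exp_add, ← Real.exp_add]; ring_nf
  have ex := Real.add_one_le_exp x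
  calc _ ≤ E * (d * x) * (1 + 2 * E) + 2 * E ^ 2 * (4 * d) := hR.trans (by gcongr)
    _ ≤ E * (d * x) * (E + 2 * E) + 2 * E ^ 2 * (4 * d) := by gcongr
    _ = d * (E * E) * (3 * x + 8) := by ring
    _ ≤ d * (E * E) * (11 * Real.exp x) := by gcongr; linarith
    _ = _ := by rw [e5]; ring

end IsGrowthRate

/-! ### The fixed-point map and its contraction property. -/

/-- The fixed-point map for the growth rate. -/
noncomputable def growthMap (κ : ℝ → ℝ) (b : ℝ) (φ : ℝ → ℝ) (X : ℝ) : ℝ :=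
  1 + 1 / b * ∫ p : ℝ × ℝ, correctionKernel κ p
    * (bumpRatio (Real.exp (logit b φ X - logit b φ (X - p.1))) (mass b φ X) * φ (X - p.1))
    * density b φ (X + p.2)

theorem IsLogKernel.formConst_pos {κ : ℝ → ℝ} {K₀ α : ℝ} (h : IsLogKernel κ K₀ α) :
    0 < formConst K₀ α := by
  have := h.K₀_pos
  have := h.α_pos
  rw [formConst]
  positivity

/-- The threshold `400 * formConst K₀ α` serves all needs at once: 4 ≤ b, 5/b ≤ α/2, the contraction
factor `167 * formConst K₀ α / b` and the absorption factor `16 * formConst K₀ α / b` both at most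
1/2. -/
theorem IsLogKernel.four_le_of_large {κ : ℝ → ℝ} {K₀ α b : ℝ} (h : IsLogKernel κ K₀ α)
    (hb : 400 * formConst K₀ α ≤ b) : 4 ≤ b := by
  have h1 := h.K₀_pos
  have h2 := h.α_pos
  have h3 : 0 < 2 / α := by positivity
  rw [formConst] at hb
  nlinarith [mul_pos h1 h3]

theorem IsLogKernel.five_div_le {κ : ℝ → ℝ} {K₀ α b : ℝ} (h : IsLogKernel κ K₀ α)
    (hb : 400 * formConst K₀ α ≤ b) : 5 / b ≤ α / 2 := by
  have h1 := h.K₀_pos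
  have h2 := h.α_pos
  have h3 : 0 < 2 / α := by positivity
  have h4 := h.four_le_of_large hb
  rw [formConst] at hb
  have h5 : 5 * (2 / α) ≤ b := by nlinarith [mul_pos h1 h3]
  rw [div_le_div_iff₀ (by linarith) two_pos]
  have : α * (5 * (2 / α)) ≤ α * b := by gcongr
  have e : α * (5 * (2 / α)) = 10 := by field_simp; norm_num
  linarith

theorem IsLogKernel.exp_le_of_large {κ : ℝ → ℝ} {K₀ α b : ℝ} (h : IsLogKernel κ K₀ α)
    (hb : 400 * formConst K₀ α ≤ b) {s : ℝ} (hs : 0 ≤ s) :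
    Real.exp (5 * s / b) ≤ Real.exp (α / 2 * s) := by
  refine Real.exp_le_exp.2 ?_
  have := mul_le_mul_of_nonneg_right (h.five_div_le hb) hs
  calc _ = 5 / b * s := by ring
    _ ≤ _ := this

theorem IsLogKernel.exp_two_le_of_large {κ : ℝ → ℝ} {K₀ α b : ℝ} (h : IsLogKernel κ K₀ α)
    (hb : 400 * formConst K₀ α ≤ b) {s : ℝ} (hs : 0 ≤ s) :
    Real.exp (2 * s / b) ≤ Real.exp (α / 2 * s) := by
  refine le_trans (Real.exp_le_exp.2 ?_) (h.exp_le_of_large hb hs)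
  have := h.four_le_of_large hb
  gcongr
  norm_num

theorem correctionKernel_of_fst_nonpos (κ : ℝ → ℝ) {p : ℝ × ℝ} (hs : p.1 ≤ 0) :
    correctionKernel κ p = 0 :=
  IsLogKernel.correctionKernel_of_notMem κ (fun hp => absurd hp.1 (not_lt.2 hs)) (Or.inr hs)

namespace IsGrowthRate

variable {κ φ φ₁ φ₂ : ℝ → ℝ} {K₀ α b d : ℝ}

theorem continuous_shape (h : IsGrowthRate φ) :
    Continuous fun p : ℝ × ℝ =>
      bumpRatio (Real.exp (logit b φ p.1 - logit b φ (p.1 - p.2))) (mass b φ p.1)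
        * φ (p.1 - p.2) := by
  have c1 := h.continuous_logit (b := b)
  have c2 := h.continuous_mass (b := b)
  have c3 := h.continuous
  have cE : Continuous fun p : ℝ × ℝ => Real.exp (logit b φ p.1 - logit b φ (p.1 - p.2)) := by
    fun_prop
  have cM : Continuous fun p : ℝ × ℝ => mass b φ p.1 := by fun_prop
  refine Continuous.mul (cE.div₀ (by fun_prop) fun p => ?_) (by fun_prop)
  have h0 := mass_pos b φ p.1
  have h1 := sub_pos.2 (mass_lt_one b φ p.1)
  positivity

theorem abs_shape_le (h : IsGrowthRate φ) (hκ : IsLogKernel κ K₀ α)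
    (hb : 400 * formConst K₀ α ≤ b) (X : ℝ) {s : ℝ} (hs : 0 ≤ s) :
    |bumpRatio (Real.exp (logit b φ X - logit b φ (X - s))) (mass b φ X) * φ (X - s)|
      ≤ 2 * Real.exp (α / 2 * s) := by
  have hb0 : 0 < b := by linarith [hκ.four_le_of_large hb]
  have hle : X - s ≤ X := by linarith
  have a := h.one_le_exp_logit_sub hb0 hle
  have a' := h.exp_logit_sub_le hb0 hle
  rw [sub_sub_cancel] at a'
  have r0 := bumpRatio_pos a (mass_pos b φ X).le (mass_lt_one b φ X).le
  have r1 := bumpRatio_le a (mass_pos b φ X).le (mass_lt_one b φ X).le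
  rw [abs_mul, abs_of_pos r0, abs_of_pos (h.pos _), mul_comm]
  exact mul_le_mul (h.upper _) (r1.trans (a'.trans (hκ.exp_two_le_of_large hb hs))) r0.le two_pos.le

/-- The condition 5/b ≤ α/2 is used here: the growth in s of the difference must still fit the
weight allowed by `integrable_form`. The constant is 23 = 1 + 2 · 11. -/
theorem abs_shape_sub_le (h₁ : IsGrowthRate φ₁) (h₂ : IsGrowthRate φ₂) (hκ : IsLogKernel κ K₀ α)
    (hb : 400 * formConst K₀ α ≤ b) (hd : ∀ X, |φ₁ X - φ₂ X| ≤ d) (X : ℝ) {s : ℝ} (hs : 0 ≤ s) :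
    |bumpRatio (Real.exp (logit b φ₁ X - logit b φ₁ (X - s))) (mass b φ₁ X) * φ₁ (X - s)
      - bumpRatio (Real.exp (logit b φ₂ X - logit b φ₂ (X - s))) (mass b φ₂ X) * φ₂ (X - s)|
      ≤ 23 * d * Real.exp (α / 2 * s) := by
  have hb0 : 0 < b := by linarith [hκ.four_le_of_large hb]
  have hle : X - s ≤ X := by linarith
  have d0 : 0 ≤ d := (abs_nonneg _).trans (hd 0)
  have a := h₁.one_le_exp_logit_sub hb0 hle
  have a' := h₁.exp_logit_sub_le hb0 hle
  rw [sub_sub_cancel] at a'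
  have r0 := bumpRatio_pos a (mass_pos b φ₁ X).le (mass_lt_one b φ₁ X).le
  have r1 := bumpRatio_le a (mass_pos b φ₁ X).le (mass_lt_one b φ₁ X).le
  have rd := h₁.abs_bumpRatio_logit_sub_le h₂ hb0 hd X hs
  set R₁ := bumpRatio (Real.exp (logit b φ₁ X - logit b φ₁ (X - s))) (mass b φ₁ X)
  set R₂ := bumpRatio (Real.exp (logit b φ₂ X - logit b φ₂ (X - s))) (mass b φ₂ X)
  have split : R₁ * φ₁ (X - s) - R₂ * φ₂ (X - s)
      = R₁ * (φ₁ (X - s) - φ₂ (X - s)) + (R₁ - R₂) * φ₂ (X - s) := by ring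
  have := h₂.upper (X - s)
  have := (h₂.pos (X - s)).le
  rw [split]
  refine (abs_add_le _ _).trans ?_
  rw [abs_mul, abs_mul, abs_of_pos r0, abs_of_pos (h₂.pos _)]
  calc _ ≤ Real.exp (α / 2 * s) * d + (11 * d * Real.exp (α / 2 * s)) * 2 := by
        gcongr
        · exact r1.trans (a'.trans (hκ.exp_two_le_of_large hb hs))
        · exact hd _
        · exact rd.trans (mul_le_mul_of_nonneg_left (hκ.exp_le_of_large hb hs) (by positivity))
    _ = _ := by ring

theorem integrable_density_add (h : IsGrowthRate φ) (hb : 0 < b) (X : ℝ) :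
    Integrable fun t => density b φ (X + t) := (h.integrable_density hb).comp_add_left X

theorem integral_density_add (h : IsGrowthRate φ) (hb : 0 < b) (X : ℝ) :
    ∫ t, |density b φ (X + t)| = 1 := by
  rw [integral_add_left_eq_self (fun t => |density b φ t|) X, ← h.integral_density hb]
  exact integral_congr_ae (Eventually.of_forall fun t => abs_of_pos (h.density_pos hb t))

theorem integrable_growthMap (h : IsGrowthRate φ) (hκ : IsLogKernel κ K₀ α)
    (hb : 400 * formConst K₀ α ≤ b) (X : ℝ) :
    Integrable (fun p : ℝ × ℝ => correctionKernel κ p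
      * (bumpRatio (Real.exp (logit b φ X - logit b φ (X - p.1))) (mass b φ X) * φ (X - p.1))
      * density b φ (X + p.2)) ∧
    |∫ p : ℝ × ℝ, correctionKernel κ p
      * (bumpRatio (Real.exp (logit b φ X - logit b φ (X - p.1))) (mass b φ X) * φ (X - p.1))
      * density b φ (X + p.2)| ≤ formConst K₀ α * 2 * 1 := by
  have hb4 := hκ.four_le_of_large hb
  have hb0 : 0 < b := by linarith
  refine hκ.integrable_form (u := fun s => bumpRatio (Real.exp (logit b φ X - logit b φ (X - s)))
    (mass b φ X) * φ (X - s)) (v := fun t => density b φ (X + t)) ?_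
    (fun s hs => h.abs_shape_le hκ hb X hs.le) (h.integrable_density_add hb0 X) (fun t => ?_)
    (h.integral_density_add hb0 X).le
  · exact (h.continuous_shape.comp (Continuous.prodMk_right X)).measurable
  · rw [abs_of_pos (h.density_pos hb0 _)]
    exact h.density_le_one (by linarith) _

theorem continuous_growthMap (h : IsGrowthRate φ) (hκ : IsLogKernel κ K₀ α)
    (hb : 400 * formConst K₀ α ≤ b) : Continuous (growthMap κ b φ) := by
  have hb4 := hκ.four_le_of_large hb
  have hb0 : 0 < b := by linarith
  refine continuous_const.add (continuous_const.mul (continuous_iff_continuousAt.2 fun X₀ => ?_))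
  set c := 1 / (2 * b) with hc
  have c0 : 0 < c := by positivity
  have c1 : 1 ≤ 2 / c := by
    rw [hc, one_div, div_inv_eq_mul]; linarith
  have i := (hκ.integrable_form (u := fun s => Real.exp (α / 2 * s)) (A := 1)
    (v := fun t => Real.exp (-(c * |t|))) (V := 2 / c) (by fun_prop)
    (fun s _ => by rw [one_mul, abs_of_pos (Real.exp_pos _)]) (integrable_exp_neg_mul_abs c0)
    (fun t => by
      rw [abs_of_pos (Real.exp_pos _)]
      exact (Real.exp_le_one_iff.2 (neg_nonpos.2 (by positivity))).trans c1)
    (by simp only [abs_of_pos (Real.exp_pos _)]; exact (integral_exp_neg_mul_abs c0).le)).1.abs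
  refine continuousAt_of_dominated (bound := fun p => 2 * (2 / b * Real.exp (c * (|X₀| + 1))) *
    |correctionKernel κ p * Real.exp (α / 2 * p.1) * Real.exp (-(c * |p.2|))|)
    (Eventually.of_forall fun X => (h.integrable_growthMap hκ hb X).1.aestronglyMeasurable)
    ?_ (i.const_mul _) (Eventually.of_forall fun p => ?_)
  · filter_upwards [Metric.ball_mem_nhds X₀ one_pos] with X hX
    refine Eventually.of_forall fun p => ?_
    rcases le_or_gt p.1 0 with hs | hs
    · simp [correctionKernel_of_fst_nonpos κ hs]
    have h1 := h.abs_shape_le hκ hb X hs.le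
    -- Shifting X within a unit ball only changes the constant in the exponential bound, which gives
    -- one majorant for all nearby X.
    have h2 : density b φ (X + p.2)
        ≤ 2 / b * (Real.exp (c * (|X₀| + 1)) * Real.exp (-(c * |p.2|))) := by
      refine (h.density_le_exp hb0 _).trans ?_
      rw [← Real.exp_add]
      gcongr
      have : |p.2| ≤ |X + p.2| + |X₀| + 1 := by
        have e : p.2 = (X + p.2) + (-X₀) + (X₀ - X) := by ring
        have h3 : |X₀ - X| ≤ 1 := by
          rw [abs_sub_comm]; exact (Metric.mem_ball.1 hX).le
        calc |p.2| = |(X + p.2) + (-X₀) + (X₀ - X)| := by rw [← e]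
          _ ≤ |X + p.2| + |-X₀| + |X₀ - X| := abs_add_three _ _ _
          _ ≤ _ := by rw [abs_neg]; linarith
      nlinarith
    rw [abs_mul] at h1
    simp only [Real.norm_eq_abs, abs_mul, abs_of_pos (h.density_pos hb0 _), Real.abs_exp]
    calc _ ≤ |correctionKernel κ p| * (2 * Real.exp (α / 2 * p.1))
          * (2 / b * (Real.exp (c * (|X₀| + 1)) * Real.exp (-(c * |p.2|)))) := by
          have := (h.density_pos hb0 (X + p.2)).le
          gcongr
      _ = _ := by ring
  · refine ContinuousAt.mul (continuousAt_const.mul ?_) ?_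
    · exact (h.continuous_shape.comp (Continuous.prodMk_left p.1)).continuousAt
    · exact (h.continuous_density.comp (continuous_id.add continuous_const)).continuousAt

theorem growthMap_isGrowthRate (h : IsGrowthRate φ) (hκ : IsLogKernel κ K₀ α)
    (hb : 400 * formConst K₀ α ≤ b) : IsGrowthRate (growthMap κ b φ) := by
  have hb4 := hκ.four_le_of_large hb
  have hb0 : 0 < b := by linarith
  have key : ∀ X, |growthMap κ b φ X - 1| ≤ 1 / 2 := by
    intro X
    have := (h.integrable_growthMap hκ hb X).2
    rw [growthMap, add_sub_cancel_left, abs_mul, abs_of_pos (by positivity : 0 < 1 / b)]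
    calc _ ≤ 1 / b * (formConst K₀ α * 2 * 1) := by gcongr
      _ ≤ 1 / 2 := by
        rw [one_div_mul_eq_div, div_le_iff₀ hb0]
        linarith [hκ.formConst_pos]
  refine ⟨h.continuous_growthMap hκ hb, fun X => ?_, fun X => ?_⟩
  · linarith [(abs_le.1 (key X)).1]
  · linarith [(abs_le.1 (key X)).2]

/-- Vary the two factors one at a time: the shape contributes 23 d and the density 2 · 72 d,
together 167 d times `formConst K₀ α / b`. -/
theorem abs_growthMap_sub_le (h₁ : IsGrowthRate φ₁) (h₂ : IsGrowthRate φ₂)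
    (hκ : IsLogKernel κ K₀ α) (hb : 400 * formConst K₀ α ≤ b) (hd : ∀ X, |φ₁ X - φ₂ X| ≤ d)
    (X : ℝ) : |growthMap κ b φ₁ X - growthMap κ b φ₂ X| ≤ d / 2 := by
  have hb4 := hκ.four_le_of_large hb
  have hb0 : 0 < b := by linarith
  have d0 : 0 ≤ d := (abs_nonneg _).trans (hd 0)
  have m₁ := h₁.continuous_shape (b := b) |>.comp (Continuous.prodMk_right X)
  have m₂ := h₂.continuous_shape (b := b) |>.comp (Continuous.prodMk_right X)
  obtain ⟨iA, eA⟩ := hκ.integrable_form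
    (u := fun s => bumpRatio (Real.exp (logit b φ₁ X - logit b φ₁ (X - s))) (mass b φ₁ X)
      * φ₁ (X - s) - bumpRatio (Real.exp (logit b φ₂ X - logit b φ₂ (X - s))) (mass b φ₂ X)
      * φ₂ (X - s)) (v := fun t => density b φ₁ (X + t)) (m₁.sub m₂).measurable
    (fun s hs => h₁.abs_shape_sub_le h₂ hκ hb hd X hs.le) (h₁.integrable_density_add hb0 X)
    (fun t => by
      rw [abs_of_pos (h₁.density_pos hb0 _)]
      exact h₁.density_le_one (by linarith) _)
    (h₁.integral_density_add hb0 X).le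
  obtain ⟨iB, eB⟩ := hκ.integrable_form
    (u := fun s => bumpRatio (Real.exp (logit b φ₂ X - logit b φ₂ (X - s))) (mass b φ₂ X)
      * φ₂ (X - s)) (v := fun t => density b φ₁ (X + t) - density b φ₂ (X + t)) (V := 72 * d)
    m₂.measurable (fun s hs => h₂.abs_shape_le hκ hb X hs.le)
    ((h₁.integrable_density_add hb0 X).sub (h₂.integrable_density_add hb0 X))
    (fun t => h₁.abs_density_sub_le' h₂ (by linarith) hd _)
    (by
      rw [integral_add_left_eq_self (fun t => |density b φ₁ t - density b φ₂ t|) X]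
      exact h₁.integral_abs_density_sub_le h₂ hb0 hd)
  have split : growthMap κ b φ₁ X - growthMap κ b φ₂ X = 1 / b *
      ((∫ p : ℝ × ℝ, correctionKernel κ p *
        (bumpRatio (Real.exp (logit b φ₁ X - logit b φ₁ (X - p.1))) (mass b φ₁ X)
        * φ₁ (X - p.1) - bumpRatio (Real.exp (logit b φ₂ X - logit b φ₂ (X - p.1))) (mass b φ₂ X)
        * φ₂ (X - p.1)) * density b φ₁ (X + p.2))
      + ∫ p : ℝ × ℝ, correctionKernel κ p *
        (bumpRatio (Real.exp (logit b φ₂ X - logit b φ₂ (X - p.1))) (mass b φ₂ X) * φ₂ (X - p.1))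
        * (density b φ₁ (X + p.2) - density b φ₂ (X + p.2))) := by
    rw [← integral_add iA iB, growthMap, growthMap, add_sub_add_left_eq_sub, ← mul_sub,
      ← integral_sub (h₁.integrable_growthMap hκ hb X).1 (h₂.integrable_growthMap hκ hb X).1]
    congr 2
    ext p
    ring
  rw [split, abs_mul, abs_of_pos (by positivity : 0 < 1 / b)]
  calc _ ≤ 1 / b * (formConst K₀ α * (23 * d) * 1 + formConst K₀ α * 2 * (72 * d)) := by
        gcongr
        exact (abs_add_le _ _).trans (add_le_add eA eB)
    _ = 167 * formConst K₀ α / b * d := by ring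
    _ ≤ 1 / 2 * d := by
        refine mul_le_mul_of_nonneg_right ?_ d0
        rw [div_le_iff₀ hb0]
        linarith [hκ.formConst_pos]
    _ = d / 2 := by ring

end IsGrowthRate

-- Banach's theorem on the bounded continuous functions with values in [1/2, 2], a closed subset of
-- a complete space; the constant 1, the logistic profile, shows it is nonempty.
open BoundedContinuousFunction in
theorem IsLogKernel.exists_fixedPoint {κ : ℝ → ℝ} {K₀ α b : ℝ} (hκ : IsLogKernel κ K₀ α)
    (hb : 400 * formConst K₀ α ≤ b) : ∃ φ, IsGrowthRate φ ∧ growthMap κ b φ = φ := by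
  let S : Set (ℝ →ᵇ ℝ) := {f | ∀ x, f x ∈ Icc (1 / 2 : ℝ) 2}
  have hS : IsClosed S := by
    have : S = ⋂ x, (fun f : ℝ →ᵇ ℝ => f x) ⁻¹' Icc (1 / 2) 2 := by ext; simp [S]
    rw [this]
    exact isClosed_iInter fun x => isClosed_Icc.preimage (continuous_eval_const x)
  have : CompleteSpace S := hS.completeSpace_coe
  have gr : ∀ f : S, IsGrowthRate f.1 := fun f =>
    ⟨f.1.continuous, fun X => (f.2 X).1, fun X => (f.2 X).2⟩
  let T : S → S := fun f =>
    ⟨BoundedContinuousFunction.ofNormedAddCommGroup (growthMap κ b f.1)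
      ((gr f).continuous_growthMap hκ hb) 2 (fun X => by
        rw [Real.norm_of_nonneg (((gr f).growthMap_isGrowthRate hκ hb).pos X).le]
        exact ((gr f).growthMap_isGrowthRate hκ hb).upper X),
      fun X => ⟨((gr f).growthMap_isGrowthRate hκ hb).lower X,
        ((gr f).growthMap_isGrowthRate hκ hb).upper X⟩⟩
  have hT : ContractingWith (1 / 2) T := by
    refine ⟨NNReal.half_lt_self one_ne_zero, LipschitzWith.of_dist_le_mul fun f g => ?_⟩
    rw [Subtype.dist_eq, Subtype.dist_eq, BoundedContinuousFunction.dist_le (by positivity)]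
    intro X
    have := (gr f).abs_growthMap_sub_le (gr g) hκ hb
      (d := dist f.1 g.1) (fun X => by
        rw [← Real.dist_eq]; exact BoundedContinuousFunction.dist_coe_le_dist X) X
    rw [Real.dist_eq]
    refine this.trans_eq ?_
    simp
    ring
  have hne : Nonempty S := ⟨⟨BoundedContinuousFunction.const ℝ 1, fun x => by
    simp only [BoundedContinuousFunction.const_apply]; norm_num⟩⟩
  obtain ⟨f, hf, -⟩ := hT.exists_fixedPoint (Classical.arbitrary S) (edist_ne_top _ _)
  refine ⟨f.1, gr f, ?_⟩
  ext X
  exact congrArg (fun f : S => f.1 X) hf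

/-! ### The bilinear form and linear equations governed by it. -/

/-- The bilinear form associated with the correction kernel. -/
noncomputable def correctionForm (κ u v : ℝ → ℝ) (X : ℝ) : ℝ :=
  ∫ p : ℝ × ℝ, correctionKernel κ p * u (X - p.1) * v (X + p.2)

/-- Iterating the improvement sends the constant A to the fixed point 2c of A ↦ c + A/2. Any finite
initial bound will do; its size disappears. -/
theorem abs_le_of_absorb {f g : ℝ → ℝ} {c A₀ : ℝ} (h₀ : ∀ X, |f X| ≤ A₀ * g X)
    (step : ∀ A, (∀ X, |f X| ≤ A * g X) → ∀ X, |f X| ≤ (c + A / 2) * g X) (X : ℝ) :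
    |f X| ≤ 2 * c * g X := by
  have iter : ∀ n : ℕ, ∀ X, |f X| ≤ (2 * c + (A₀ - 2 * c) * (1 / 2) ^ n) * g X := by
    intro n
    induction n with
    | zero => simpa using h₀
    | succ n ih =>
      intro X
      refine (step _ ih X).trans_eq ?_
      ring
  have lim : Tendsto (fun n : ℕ => (2 * c + (A₀ - 2 * c) * (1 / 2) ^ n) * g X) atTop
      (𝓝 ((2 * c + (A₀ - 2 * c) * 0) * g X)) := by
    have := tendsto_pow_atTop_nhds_zero_of_lt_one (r := (1 / 2 : ℝ)) (by norm_num) (by norm_num)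
    exact ((this.const_mul _).const_add _).mul_const _
  rw [mul_zero, add_zero] at lim
  exact ge_of_tendsto' lim fun n => iter n X

/-- The equation solved by the density of a fixed point. -/
theorem density_equation {κ φ : ℝ → ℝ} {b : ℝ} (hb : 0 < b) (hfix : growthMap κ b φ = φ) (X : ℝ) :
    b * density b φ X
      = bump b φ X + correctionForm κ (density b φ) (density b φ) X := by
  have e := congrFun hfix X
  have e1 : b * density b φ X = bump b φ X * φ X := by rw [density]; field_simp
  rw [e1, ← e, growthMap, mul_add, mul_one, correctionForm, ← integral_const_mul,
    ← integral_const_mul]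
  congr 2
  ext p
  rw [density, density, bump_eq_mul_bumpRatio b φ X (X - p.1)]
  ring

namespace IsGrowthRate

variable {κ φ u u' v v' : ℝ → ℝ} {K₀ α b A A' : ℝ}

/-- The bump weight is preserved: the Harnack bound moves it from X - s to X in the first factor,
and the integral of the bump, at most 2b, bounds the second. -/
theorem integrable_correctionForm (h : IsGrowthRate φ) (hκ : IsLogKernel κ K₀ α)
    (hb : 400 * formConst K₀ α ≤ b) (cu : Continuous u) (cv : Continuous v)
    (hu : ∀ X, |u X| ≤ A * bump b φ X) (hv : ∀ X, |v X| ≤ A' * bump b φ X) (X : ℝ) :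
    Integrable (fun p : ℝ × ℝ => correctionKernel κ p * u (X - p.1) * v (X + p.2)) ∧
      |correctionForm κ u v X| ≤ 2 * b * formConst K₀ α * A * A' * bump b φ X := by
  have hb4 := hκ.four_le_of_large hb
  have hb0 : 0 < b := by linarith
  have A0 : 0 ≤ A := nonneg_of_mul_nonneg_left ((abs_nonneg _).trans (hu 0)) (bump_pos b φ 0)
  have A0' : 0 ≤ A' := nonneg_of_mul_nonneg_left ((abs_nonneg _).trans (hv 0)) (bump_pos b φ 0)
  have iv : Integrable v := ((h.integrable_bump hb0).const_mul A').mono' cv.aestronglyMeasurable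
    (Eventually.of_forall hv)
  obtain ⟨i, e⟩ := hκ.integrable_form (u := fun s => u (X - s)) (v := fun t => v (X + t))
    (A := A * bump b φ X) (V := A' * (2 * b)) (by fun_prop)
    (fun s hs => by
      refine (hu _).trans ?_
      rw [mul_assoc, mul_comm (bump b φ X)]
      refine mul_le_mul_of_nonneg_left ((h.bump_le_mul_bump hb0 X (X - s)).trans ?_) A0
      refine mul_le_mul_of_nonneg_right ?_ (bump_pos _ _ _).le
      rw [sub_sub_cancel_left, abs_neg, abs_of_pos hs]
      exact hκ.exp_two_le_of_large hb hs.le) (iv.comp_add_left X)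
    (fun t => (hv _).trans (by gcongr; linarith [bump_le_quarter b φ (X + t)]))
    (by
      rw [integral_add_left_eq_self (fun t => |v t|) X]
      refine (integral_mono iv.abs ((h.integrable_bump hb0).const_mul A') hv).trans ?_
      rw [integral_const_mul]
      exact mul_le_mul_of_nonneg_left (h.integral_bump_le hb0) A0')
  refine ⟨i, e.trans_eq ?_⟩
  ring

theorem exp_two_div_le {b : ℝ} (hb : 4 ≤ b) {r : ℝ} (hr : r ≤ 1) : Real.exp (2 * r / b) ≤ 2 := by
  have h1 : 2 * r / b ≤ 1 / 2 := by
    rw [div_le_div_iff₀ (by linarith) two_pos]; linarith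
  have : Real.exp (1 / 2) * Real.exp (1 / 2) = Real.exp 1 := by rw [← Real.exp_add]; norm_num
  have h2 : Real.exp (1 / 2) ≤ 2 := by nlinarith [exp_one_le_three, Real.exp_pos (1 / 2)]
  exact (Real.exp_le_exp.2 h1).trans h2

theorem bump_add_le (h : IsGrowthRate φ) (hb : 4 ≤ b) {r : ℝ} (hr : |r| ≤ 1) (X : ℝ) :
    bump b φ (X + r) ≤ 2 * bump b φ X := by
  refine (h.bump_le_mul_bump (by linarith) X (X + r)).trans ?_
  rw [add_sub_cancel_left]
  exact mul_le_mul_of_nonneg_right (exp_two_div_le hb hr) (bump_pos _ _ _).le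

theorem density_add_le (h : IsGrowthRate φ) (hb : 4 ≤ b) {r : ℝ} (hr : |r| ≤ 1) (X : ℝ) :
    density b φ (X + r) ≤ 4 / b * bump b φ X := by
  have hb0 : 0 < b := by linarith
  refine (h.density_le hb0 _).trans ?_
  calc _ ≤ 2 / b * (2 * bump b φ X) := by gcongr; exact h.bump_add_le hb hr X
    _ = _ := by ring

theorem abs_density_add_le (h : IsGrowthRate φ) (hb : 4 ≤ b) {r : ℝ} (hr : |r| ≤ 1) (X : ℝ) :
    |density b φ (X + r)| ≤ 4 / b * bump b φ X := by
  rw [abs_of_pos (h.density_pos (by linarith) _)]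
  exact h.density_add_le hb hr X

theorem abs_density_le (h : IsGrowthRate φ) (hb : 4 ≤ b) (X : ℝ) :
    |density b φ X| ≤ 4 / b * bump b φ X := by
  simpa using h.abs_density_add_le hb (r := 0) (by simp) X

/-- Linear equations governed by the form are solved with a bound on the source. -/
theorem abs_le_of_linear_equation (h : IsGrowthRate φ) (hκ : IsLogKernel κ K₀ α)
    (hb : 400 * formConst K₀ α ≤ b) {f r v₁ v₂ : ℝ → ℝ} {A₀ R : ℝ} (cf : Continuous f)
    (c₁ : Continuous v₁) (c₂ : Continuous v₂) (hf : ∀ X, |f X| ≤ A₀ * bump b φ X)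
    (hr : ∀ X, |r X| ≤ R * bump b φ X) (h₁ : ∀ X, |v₁ X| ≤ 4 / b * bump b φ X)
    (h₂ : ∀ X, |v₂ X| ≤ 4 / b * bump b φ X)
    (eq : ∀ X, b * f X = r X + (correctionForm κ f v₁ X + correctionForm κ v₂ f X)) (X : ℝ) :
    |f X| ≤ 2 * (R / b) * bump b φ X := by
  have hb4 := hκ.four_le_of_large hb
  have hb0 : 0 < b := by linarith
  refine abs_le_of_absorb hf (fun A hA X => ?_) X
  have A0 : 0 ≤ A := nonneg_of_mul_nonneg_left ((abs_nonneg _).trans (hA 0)) (bump_pos b φ 0)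
  have e₁ := (h.integrable_correctionForm hκ hb cf c₁ hA h₁ X).2
  have e₂ := (h.integrable_correctionForm hκ hb c₂ cf h₂ hA X).2
  have m0 := bump_pos b φ X
  -- Each form costs `2 * b * formConst K₀ α * A * (4 / b)`; their sum is at most b A / 2 by the
  -- threshold on b.
  have key : b * |f X| ≤ (R + 16 * formConst K₀ α * A) * bump b φ X := by
    rw [← abs_of_pos hb0, ← abs_mul, abs_of_pos hb0, eq]
    calc _ ≤ R * bump b φ X + (2 * b * formConst K₀ α * A * (4 / b) * bump b φ X
          + 2 * b * formConst K₀ α * (4 / b) * A * bump b φ X) :=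
          (abs_add_le _ _).trans (add_le_add (hr X) ((abs_add_le _ _).trans (add_le_add e₁ e₂)))
      _ = _ := by field_simp; ring
  have key2 : b * |f X| ≤ b * ((R / b + A / 2) * bump b φ X) := by
    refine key.trans ?_
    rw [← mul_assoc]
    refine mul_le_mul_of_nonneg_right ?_ m0.le
    rw [mul_add, mul_div_cancel₀ _ hb0.ne']
    nlinarith [hκ.formConst_pos]
  exact le_of_mul_le_mul_left key2 hb0

/-! ### Regularity by translations and difference quotients. -/

theorem correctionForm_translate (κ u v : ℝ → ℝ) (X r : ℝ) :
    correctionForm κ u v (X + r)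
      = correctionForm κ (fun Y => u (Y + r)) (fun Y => v (Y + r)) X := by
  rw [correctionForm, correctionForm]
  congr 1
  ext p
  rw [show X + r - p.1 = X - p.1 + r by ring, show X + r + p.2 = X + p.2 + r by ring]

theorem hasDerivAt_bump (h : IsGrowthRate φ) (X : ℝ) :
    HasDerivAt (bump b φ) ((1 - 2 * mass b φ X) * density b φ X) X := by
  have := (h.hasDerivAt_mass (b := b) X).mul ((h.hasDerivAt_mass (b := b) X).const_sub 1)
  refine this.congr_deriv ?_
  ring

theorem abs_one_sub_two_mul_mass_le (b : ℝ) (φ : ℝ → ℝ) (X : ℝ) : |1 - 2 * mass b φ X| ≤ 1 := by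
  rw [abs_le]
  constructor <;> linarith [mass_pos b φ X, mass_lt_one b φ X]

theorem abs_le_of_mem_uIcc {X r Y : ℝ} (hY : Y ∈ uIcc X (X + r)) : |Y - X| ≤ |r| := by
  have := abs_sub_left_of_mem_uIcc hY
  rwa [add_sub_cancel_left] at this

theorem abs_bump_add_sub_le (h : IsGrowthRate φ) (hb : 4 ≤ b) {r : ℝ} (hr : |r| ≤ 1) (X : ℝ) :
    |bump b φ (X + r) - bump b φ X| ≤ 4 / b * |r| * bump b φ X := by
  have bound : ∀ Y ∈ uIcc X (X + r),
      ‖(1 - 2 * mass b φ Y) * density b φ Y‖ ≤ 4 / b * bump b φ X := by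
    intro Y hY
    have hY' : |Y - X| ≤ 1 := (abs_le_of_mem_uIcc hY).trans hr
    rw [Real.norm_eq_abs, abs_mul]
    have := h.abs_density_add_le hb hY' X
    rw [add_sub_cancel] at this
    exact (mul_le_of_le_one_left (abs_nonneg _) (abs_one_sub_two_mul_mass_le b φ Y)).trans this
  have := (convex_uIcc X (X + r)).norm_image_sub_le_of_norm_hasDerivWithin_le
    (fun Y _ => (h.hasDerivAt_bump Y).hasDerivWithinAt) bound left_mem_uIcc right_mem_uIcc
  rw [add_sub_cancel_left, Real.norm_eq_abs, Real.norm_eq_abs] at this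
  refine this.trans_eq ?_
  ring

/-- With w_r the translate and B the form, B(w_r, w_r) - B(w, w) = B(w_r - w, w_r) + B(w, w_r - w),
so the difference solves a linear equation whose source is the increment of the bump, of order |r|.
-/
theorem abs_density_add_sub_le (h : IsGrowthRate φ) (hκ : IsLogKernel κ K₀ α)
    (hb : 400 * formConst K₀ α ≤ b) (hfix : growthMap κ b φ = φ) {r : ℝ} (hr : |r| ≤ 1) (X : ℝ) :
    |density b φ (X + r) - density b φ X| ≤ |r| * bump b φ X := by
  have hb4 := hκ.four_le_of_large hb
  have hb0 : 0 < b := by linarith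
  have cw := h.continuous_density (b := b)
  have cwr : Continuous fun Y => density b φ (Y + r) := by fun_prop
  have apriori : ∀ X, |density b φ (X + r) - density b φ X| ≤ (4 / b + 4 / b) * bump b φ X := by
    intro X
    rw [add_mul]
    exact (abs_sub _ _).trans (add_le_add (h.abs_density_add_le hb4 hr X) (h.abs_density_le hb4 X))
  have main := h.abs_le_of_linear_equation hκ hb
    (f := fun Y => density b φ (Y + r) - density b φ Y)
    (r := fun Y => bump b φ (Y + r) - bump b φ Y) (v₁ := fun Y => density b φ (Y + r))
    (v₂ := density b φ) (cwr.sub cw) cwr cw apriori (h.abs_bump_add_sub_le hb4 hr)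
    (h.abs_density_add_le hb4 hr) (h.abs_density_le hb4)
    (fun X => by
      have i₁ := (h.integrable_correctionForm hκ hb cwr cwr (h.abs_density_add_le hb4 hr)
        (h.abs_density_add_le hb4 hr) X).1
      have i₂ := (h.integrable_correctionForm hκ hb cw cw (h.abs_density_le hb4)
        (h.abs_density_le hb4) X).1
      have j₁ := (h.integrable_correctionForm hκ hb (cwr.sub cw) cwr apriori
        (h.abs_density_add_le hb4 hr) X).1
      have j₂ := (h.integrable_correctionForm hκ hb cw (cwr.sub cw) (h.abs_density_le hb4)
        apriori X).1
      rw [mul_sub, density_equation hb0 hfix, density_equation hb0 hfix,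
        correctionForm_translate, add_sub_add_comm]
      congr 1
      simp only [Pi.sub_apply] at j₁ j₂
      simp only [correctionForm]
      rw [← integral_sub i₁ i₂, ← integral_add j₁ j₂]
      congr 1
      ext p
      ring) X
  refine main.trans ?_
  have m0 := bump_pos b φ X
  have : 2 * (4 / b * |r| / b) ≤ |r| := by
    have e : 2 * (4 / b * |r| / b) = 8 / b ^ 2 * |r| := by ring
    rw [e]
    refine mul_le_of_le_one_left (abs_nonneg _) ?_
    rw [div_le_one (by positivity)]
    nlinarith
  exact mul_le_mul_of_nonneg_right this m0.le

theorem abs_mass_add_sub_le (h : IsGrowthRate φ) (hb : 4 ≤ b) (X Y : ℝ) :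
    |mass b φ Y - mass b φ X| ≤ |Y - X| := by
  have := convex_univ.norm_image_sub_le_of_norm_hasDerivWithin_le (x := X) (y := Y) (C := 1)
    (fun Y _ => (h.hasDerivAt_mass (b := b) Y).hasDerivWithinAt)
    (fun Y _ => by
      rw [Real.norm_of_nonneg (h.density_pos (by linarith) _).le]
      exact h.density_le_one (by linarith) _) (mem_univ _) (mem_univ _)
  simpa using this

/-- The derivative (1 - 2M) w of the bump is Lipschitz in the bump weight, because w is; the mean
value inequality is applied after subtracting the tangent. -/
theorem abs_bump_quotient_sub_le (h : IsGrowthRate φ) (hκ : IsLogKernel κ K₀ α)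
    (hb : 400 * formConst K₀ α ≤ b) (hfix : growthMap κ b φ = φ) {r : ℝ} (hr : |r| ≤ 1)
    (hr0 : r ≠ 0) (X : ℝ) :
    |(bump b φ (X + r) - bump b φ X) / r - (1 - 2 * mass b φ X) * density b φ X|
      ≤ 3 * |r| * bump b φ X := by
  have hb4 := hκ.four_le_of_large hb
  have hb0 : 0 < b := by linarith
  have m0 := bump_pos b φ X
  set D := (1 - 2 * mass b φ X) * density b φ X with hD
  have bound : ∀ Y ∈ uIcc X (X + r),
      ‖(1 - 2 * mass b φ Y) * density b φ Y - D‖ ≤ 3 * |r| * bump b φ X := by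
    intro Y hY
    have hY' : |Y - X| ≤ |r| := abs_le_of_mem_uIcc hY
    have hw := h.abs_density_add_sub_le hκ hb hfix (hY'.trans hr) X
    rw [add_sub_cancel] at hw
    have hM := h.abs_mass_add_sub_le hb4 X Y
    have hd : |density b φ X| ≤ bump b φ X := by
      refine (h.abs_density_le hb4 X).trans (mul_le_of_le_one_left m0.le ?_)
      rwa [div_le_one hb0]
    have split : (1 - 2 * mass b φ Y) * density b φ Y - D
        = (1 - 2 * mass b φ Y) * (density b φ Y - density b φ X)
          - 2 * (mass b φ Y - mass b φ X) * density b φ X := by rw [hD]; ring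
    rw [split, Real.norm_eq_abs]
    refine (abs_sub _ _).trans ?_
    rw [abs_mul, abs_mul, abs_mul, abs_two]
    have hM' := hM.trans hY'
    calc _ ≤ 1 * (|r| * bump b φ X) + 2 * |r| * bump b φ X := by
          refine add_le_add (mul_le_mul (abs_one_sub_two_mul_mass_le b φ Y)
            (hw.trans (by gcongr)) (abs_nonneg _) one_pos.le) ?_
          refine mul_le_mul ?_ hd (abs_nonneg _) (by positivity)
          linarith
      _ = _ := by ring
  have := (convex_uIcc X (X + r)).norm_image_sub_le_of_norm_hasDerivWithin_le
    (f := fun Y => bump b φ Y - D * Y)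
    (fun Y _ => ((h.hasDerivAt_bump Y).sub (((hasDerivAt_id Y).const_mul D).congr_deriv
      (mul_one D))).hasDerivWithinAt) bound left_mem_uIcc right_mem_uIcc
  rw [add_sub_cancel_left, Real.norm_eq_abs, Real.norm_eq_abs] at this
  have e : (bump b φ (X + r) - bump b φ X) / r - D
      = ((bump b φ (X + r) - D * (X + r)) - (bump b φ X - D * X)) / r := by
    field_simp; ring
  rw [e, abs_div, div_le_iff₀ (abs_pos.2 hr0)]
  exact this

/-- With q_r, q_k the quotients, the difference of the quadratic terms is B(q_r - q_k, w_r) + B(w,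
q_r - q_k) + B(q_k, w_r - w_k). The first two are absorbed; the last is of order |r| + |k| by the
Lipschitz bound and joins the source. -/
theorem abs_density_quotient_sub_le (h : IsGrowthRate φ) (hκ : IsLogKernel κ K₀ α)
    (hb : 400 * formConst K₀ α ≤ b) (hfix : growthMap κ b φ = φ) {r k : ℝ} (hr : |r| ≤ 1)
    (hr0 : r ≠ 0) (hk : |k| ≤ 1) (hk0 : k ≠ 0) (X : ℝ) :
    |(density b φ (X + r) - density b φ X) / r - (density b φ (X + k) - density b φ X) / k|
      ≤ 2 * ((3 + 2 * b * formConst K₀ α) / b) * (|r| + |k|) * bump b φ X := by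
  have hb4 := hκ.four_le_of_large hb
  have hb0 : 0 < b := by linarith
  have cw := h.continuous_density (b := b)
  have cwr : Continuous fun Y => density b φ (Y + r) := by fun_prop
  have cwk : Continuous fun Y => density b φ (Y + k) := by fun_prop
  have cqr : Continuous fun Y => (density b φ (Y + r) - density b φ Y) / r := by fun_prop
  have cqk : Continuous fun Y => (density b φ (Y + k) - density b φ Y) / k := by fun_prop
  have quot : ∀ {l : ℝ}, |l| ≤ 1 → l ≠ 0 → ∀ X,
      |(density b φ (X + l) - density b φ X) / l| ≤ 1 * bump b φ X := by
    intro l hl hl0 X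
    rw [abs_div, div_le_iff₀ (abs_pos.2 hl0)]
    refine (h.abs_density_add_sub_le hκ hb hfix hl X).trans_eq ?_
    ring
  have diff : ∀ X, |density b φ (X + r) - density b φ (X + k)| ≤ (|r| + |k|) * bump b φ X := by
    intro X
    have e : density b φ (X + r) - density b φ (X + k) = (density b φ (X + r) - density b φ X)
      - (density b φ (X + k) - density b φ X) := by ring
    rw [e, add_mul]
    exact (abs_sub _ _).trans (add_le_add (h.abs_density_add_sub_le hκ hb hfix hr X)
      (h.abs_density_add_sub_le hκ hb hfix hk X))
  have apriori : ∀ X, |(density b φ (X + r) - density b φ X) / r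
      - (density b φ (X + k) - density b φ X) / k| ≤ (1 + 1) * bump b φ X := by
    intro X
    rw [add_mul]
    exact (abs_sub _ _).trans (add_le_add (quot hr hr0 X) (quot hk hk0 X))
  have main := h.abs_le_of_linear_equation hκ hb (R := (3 + 2 * b * formConst K₀ α) * (|r| + |k|))
    (f := fun Y => (density b φ (Y + r) - density b φ Y) / r
      - (density b φ (Y + k) - density b φ Y) / k)
    (r := fun Y => ((bump b φ (Y + r) - bump b φ Y) / r - (bump b φ (Y + k) - bump b φ Y) / k)
      + correctionForm κ (fun Y => (density b φ (Y + k) - density b φ Y) / k)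
        (fun Y => density b φ (Y + r) - density b φ (Y + k)) Y)
    (v₁ := fun Y => density b φ (Y + r)) (v₂ := density b φ) (cqr.sub cqk) cwr cw apriori
    (fun X => by
      have b₁ := h.abs_bump_quotient_sub_le hκ hb hfix hr hr0 X
      have b₂ := h.abs_bump_quotient_sub_le hκ hb hfix hk hk0 X
      have b₃ := (h.integrable_correctionForm hκ hb cqk (cwr.sub cwk) (quot hk hk0) diff X).2
      rw [abs_sub_comm] at b₂
      refine (abs_add_le _ _).trans ((add_le_add ((abs_sub_le _ _ _).trans (add_le_add b₁ b₂))
        b₃).trans_eq ?_)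
      ring)
    (h.abs_density_add_le hb4 hr) (h.abs_density_le hb4)
    (fun X => by
      have ir := (h.integrable_correctionForm hκ hb cwr cwr (h.abs_density_add_le hb4 hr)
        (h.abs_density_add_le hb4 hr) X).1
      have ik := (h.integrable_correctionForm hκ hb cwk cwk (h.abs_density_add_le hb4 hk)
        (h.abs_density_add_le hb4 hk) X).1
      have i₀ := (h.integrable_correctionForm hκ hb cw cw (h.abs_density_le hb4)
        (h.abs_density_le hb4) X).1
      have j₁ := (h.integrable_correctionForm hκ hb (cqr.sub cqk) cwr apriori
        (h.abs_density_add_le hb4 hr) X).1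
      have j₂ := (h.integrable_correctionForm hκ hb cw (cqr.sub cqk) (h.abs_density_le hb4)
        apriori X).1
      have j₃ := (h.integrable_correctionForm hκ hb cqk (cwr.sub cwk) (quot hk hk0) diff X).1
      have e : b * ((density b φ (X + r) - density b φ X) / r
          - (density b φ (X + k) - density b φ X) / k)
          = (b * density b φ (X + r) - b * density b φ X) / r
            - (b * density b φ (X + k) - b * density b φ X) / k := by ring
      have f : (correctionForm κ (fun Y => density b φ (Y + r)) (fun Y => density b φ (Y + r)) X
            - correctionForm κ (density b φ) (density b φ) X) / r
          - (correctionForm κ (fun Y => density b φ (Y + k)) (fun Y => density b φ (Y + k)) X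
            - correctionForm κ (density b φ) (density b φ) X) / k
          = correctionForm κ (fun Y => (density b φ (Y + k) - density b φ Y) / k)
              (fun Y => density b φ (Y + r) - density b φ (Y + k)) X
            + (correctionForm κ (fun Y => (density b φ (Y + r) - density b φ Y) / r
                - (density b φ (Y + k) - density b φ Y) / k) (fun Y => density b φ (Y + r)) X
            + correctionForm κ (density b φ) (fun Y => (density b φ (Y + r) - density b φ Y) / r
                - (density b φ (Y + k) - density b φ Y) / k) X) := by
        have dr := (ir.sub i₀).div_const r
        have dk := (ik.sub i₀).div_const k
        have j₁₂ := j₁.add j₂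
        simp only [Pi.sub_def] at dr dk j₁ j₂ j₃ j₁₂
        simp only [Pi.add_def] at j₁₂
        simp only [correctionForm]
        rw [← integral_sub ir i₀, ← integral_sub ik i₀, ← integral_div, ← integral_div,
          ← integral_sub dr dk, ← integral_add j₁ j₂, ← integral_add j₃ j₁₂]
        congr 1
        ext p
        ring
      rw [e, density_equation hb0 hfix, density_equation hb0 hfix,
        density_equation hb0 hfix, correctionForm_translate, correctionForm_translate]
      linear_combination f) X
  exact main.trans_eq (by ring)

/-- The density of a fixed point is continuously differentiable. -/
theorem contDiff_density (h : IsGrowthRate φ) (hκ : IsLogKernel κ K₀ α)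
    (hb : 400 * formConst K₀ α ≤ b) (hfix : growthMap κ b φ = φ) :
    ContDiff ℝ 1 (density b φ) := by
  have hb4 := hκ.four_le_of_large hb
  have hb0 : 0 < b := by linarith
  have hF := hκ.formConst_pos
  set C := 2 * ((3 + 2 * b * formConst K₀ α) / b) with hC
  have C0 : 0 < C := by positivity
  set Q : ℝ → ℝ → ℝ := fun r X => (density b φ (X + r) - density b φ X) / r with hQ
  have cauchy : ∀ {r k : ℝ}, |r| ≤ 1 → r ≠ 0 → |k| ≤ 1 → k ≠ 0 → ∀ X,
      |Q r X - Q k X| ≤ C * (|r| + |k|) := by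
    intro r k hr hr0 hk hk0 X
    refine (h.abs_density_quotient_sub_le hκ hb hfix hr hr0 hk hk0 X).trans
      (mul_le_of_le_one_right (by positivity) ?_)
    linarith [bump_le_quarter b φ X]
  let t : ℕ → ℝ := fun n => 1 / ((n : ℝ) + 1)
  have t0 : ∀ n, 0 < t n := fun n => Nat.one_div_pos_of_nat
  have t1 : ∀ n, |t n| ≤ 1 := fun n => by
    rw [abs_of_pos (t0 n), div_le_one (by positivity)]
    linarith [Nat.cast_nonneg (α := ℝ) n]
  have tlim : Tendsto t atTop (𝓝 0) := tendsto_one_div_add_atTop_nhds_zero_nat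
  have limit : ∀ X, ∃ l, ∀ r, |r| ≤ 1 → r ≠ 0 → |Q r X - l| ≤ C * |r| := by
    intro X
    have cs : CauchySeq fun n => Q (t n) X := by
      refine cauchySeq_of_le_tendsto_0' (fun n => C * (t n + t n)) (fun n m hnm => ?_) ?_
      · rw [Real.dist_eq]
        refine (cauchy (t1 n) (t0 n).ne' (t1 m) (t0 m).ne' X).trans ?_
        rw [abs_of_pos (t0 n), abs_of_pos (t0 m)]
        gcongr
        exact Nat.one_div_le_one_div hnm
      · simpa using (tlim.add tlim).const_mul C
    obtain ⟨l, hl⟩ := cauchySeq_tendsto_of_complete cs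
    refine ⟨l, fun r hr hr0 => ?_⟩
    have lhs : Tendsto (fun n => |Q r X - Q (t n) X|) atTop (𝓝 |Q r X - l|) :=
      (hl.const_sub _).abs
    have rhs : Tendsto (fun n => C * (|r| + |t n|)) atTop (𝓝 (C * (|r| + |0|))) :=
      (tlim.abs.const_add _).const_mul _
    rw [abs_zero, add_zero] at rhs
    exact le_of_tendsto_of_tendsto' lhs rhs fun n => cauchy hr hr0 (t1 n) (t0 n).ne' X
  choose ψ hψ using limit
  have deriv_eq : ∀ X, HasDerivAt (density b φ) (ψ X) X := by
    intro X
    rw [hasDerivAt_iff_tendsto_slope_zero, tendsto_iff_norm_sub_tendsto_zero]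
    refine squeeze_zero' (Eventually.of_forall fun _ => norm_nonneg _)
      (g := fun r => C * |r|) ?_ ?_
    · have near : ∀ᶠ r in 𝓝[≠] (0 : ℝ), |r| ≤ 1 := by
        refine eventually_nhdsWithin_of_eventually_nhds ?_
        filter_upwards [Metric.ball_mem_nhds (0 : ℝ) one_pos] with r hr
        simpa using (Metric.mem_ball.1 hr).le
      filter_upwards [near, self_mem_nhdsWithin] with r hr hr0
      have := hψ X r hr hr0
      simp only [hQ, div_eq_inv_mul] at this
      exact this
    · have : Tendsto (fun r : ℝ => C * |r|) (𝓝 0) (𝓝 (C * |0|)) :=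
        (continuous_const.mul continuous_abs).tendsto 0
      rw [abs_zero, mul_zero] at this
      exact this.mono_left nhdsWithin_le_nhds
  -- The error C|r| does not depend on X, so the derivative is a uniform limit of continuous
  -- quotients.
  have cψ : Continuous ψ := by
    refine continuous_of_uniform_approx_of_continuous fun U hU => ?_
    obtain ⟨ε, ε0, hε⟩ := Metric.mem_uniformity_dist.1 hU
    obtain ⟨n, hn⟩ := ((tlim.const_mul C).eventually (gt_mem_nhds (by simpa using ε0))).exists
    have cw := h.continuous_density (b := b)
    refine ⟨Q (t n), by fun_prop, fun X => hε ?_⟩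
    rw [dist_comm, Real.dist_eq]
    refine (hψ X (t n) (t1 n) (t0 n).ne').trans_lt ?_
    rwa [abs_of_pos (t0 n)]
  rw [contDiff_one_iff_deriv]
  refine ⟨fun X => (deriv_eq X).differentiableAt, ?_⟩
  rwa [show deriv (density b φ) = ψ from funext fun X => (deriv_eq X).deriv]

end IsGrowthRate

/-! ### Asymptotics of the growth rate and of the density. -/

theorem integral_diagonalKernel {t : ℝ} (ht : t < 0) :
    ∫ s : ℝ, (interactionDomain ∩ {p | p.2 ≤ 0}).indicator
      (fun p => Real.exp (-(p.1 + p.2))) (s, t) = 1 := by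
  have et : Real.exp t < 1 := by simpa using ht
  -- The slice of the domain at height t < 0 is 0 < s < S, and exp (-t) (1 - exp (-S)) = 1.
  set S := -Real.log (1 - Real.exp t) with hS
  have eS : Real.exp (-S) = 1 - Real.exp t := by
    rw [hS, neg_neg, Real.exp_log (by linarith)]
  have S0 : 0 ≤ S := by
    have : Real.exp (-S) ≤ 1 := by rw [eS]; linarith [Real.exp_pos t]
    linarith [Real.exp_le_one_iff.1 this]
  have slice : (fun s : ℝ => (interactionDomain ∩ {p | p.2 ≤ 0}).indicator
      (fun p => Real.exp (-(p.1 + p.2))) (s, t))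
      = (Ioo 0 S).indicator fun s => Real.exp (-(s + t)) := by
    ext s
    have : (s, t) ∈ interactionDomain ∩ {p | p.2 ≤ 0} ↔ s ∈ Ioo 0 S := by
      have h1 : (1 < Real.exp t + Real.exp (-s)) ↔ s < S := by
        rw [← neg_lt_neg_iff (a := S), ← Real.exp_lt_exp (x := -S), eS]
        constructor <;> intro h <;> linarith
      constructor
      · rintro ⟨⟨h2, h3⟩, -⟩
        exact ⟨h2, h1.1 h3⟩
      · rintro ⟨h2, h3⟩
        exact ⟨⟨h2, h1.2 h3⟩, ht.le⟩
    by_cases hs : s ∈ Ioo 0 S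
    · rw [indicator_of_mem hs, indicator_of_mem (this.2 hs)]
    · rw [indicator_of_notMem hs, indicator_of_notMem fun h => hs (this.1 h)]
  rw [slice, integral_indicator measurableSet_Ioo, ← integral_Ioc_eq_integral_Ioo,
    ← intervalIntegral.integral_of_le S0]
  have deriv : ∀ s ∈ uIcc 0 S,
      HasDerivAt (fun s => -Real.exp (-(s + t))) (Real.exp (-(s + t))) s := by
    intro s _
    have := (((hasDerivAt_id s).add_const t).neg.exp).neg
    refine this.congr_deriv ?_
    simp
  rw [intervalIntegral.integral_eq_sub_of_hasDerivAt deriv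
    (Continuous.intervalIntegrable (by fun_prop) _ _)]
  have e1 : Real.exp (-(S + t)) = (1 - Real.exp t) * Real.exp (-t) := by
    rw [← eS, ← Real.exp_add]; ring_nf
  have e2 : Real.exp t * Real.exp (-t) = 1 := by rw [← Real.exp_add]; simp
  rw [e1, zero_add]
  linear_combination e2

namespace IsGrowthRate

variable {κ φ : ℝ → ℝ} {K₀ α b : ℝ}

theorem integral_diagonalKernel_mul_density (h : IsGrowthRate φ) (hb : 0 < b) {X : ℝ}
    (hint : Integrable fun p : ℝ × ℝ => (interactionDomain ∩ {p | p.2 ≤ 0}).indicator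
      (fun p => Real.exp (-(p.1 + p.2))) p * density b φ X * density b φ (X + p.2)) :
    ∫ p : ℝ × ℝ, (interactionDomain ∩ {p | p.2 ≤ 0}).indicator
      (fun p => Real.exp (-(p.1 + p.2))) p * density b φ X * density b φ (X + p.2)
      = density b φ X * mass b φ X := by
  rw [Measure.volume_eq_prod, integral_prod_symm _ hint]
  have inner : ∀ᵐ t : ℝ, ∫ s : ℝ, (interactionDomain ∩ {p | p.2 ≤ 0}).indicator
      (fun p => Real.exp (-(p.1 + p.2))) (s, t) * density b φ X * density b φ (X + t)
      = density b φ X * (Iic X).indicator (density b φ) (X + t) := by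
    have : ∀ᵐ t : ℝ, t ≠ 0 := by simp [ae_iff]
    filter_upwards [this] with t ht
    rw [integral_mul_const, integral_mul_const]
    rcases lt_or_gt_of_ne ht with ht | ht
    · rw [integral_diagonalKernel ht, indicator_of_mem (show X + t ∈ Iic X by
        rw [mem_Iic]; linarith), one_mul]
    · rw [indicator_of_notMem (show X + t ∉ Iic X by rw [mem_Iic]; linarith)]
      have : ∀ s : ℝ, (interactionDomain ∩ {p | p.2 ≤ 0}).indicator
          (fun p => Real.exp (-(p.1 + p.2))) (s, t) = 0 := fun s =>
        indicator_of_notMem (fun hp => absurd hp.2 (not_le.2 ht)) _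
      rw [integral_congr_ae (Eventually.of_forall this), integral_zero]
      ring
  rw [integral_congr_ae inner, integral_const_mul,
    integral_add_left_eq_self (fun t => (Iic X).indicator (density b φ) t) X,
    integral_indicator measurableSet_Iic, h.integral_Iic_density hb]

/-- Freeze w(X - s) at w(X), using the Lipschitz bound, and replace the kernel by its diagonal
model, which contributes w M. The remaining kernel decays in |t|, so it only sees w near X, where w
is at most of order exp (-|X|/(2b)). -/
theorem abs_correctionForm_sub_le (h : IsGrowthRate φ) (hκ : IsLogKernel κ K₀ α)
    (hb : 400 * formConst K₀ α ≤ b) (hfix : growthMap κ b φ = φ) (X : ℝ) :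
    |correctionForm κ (density b φ) (density b φ) X - density b φ X * mass b φ X|
      ≤ 14 * (1 + K₀) * ((2 / α + 6) * (8 / (b * α))) * bump b φ X
        * Real.exp (-(1 / (2 * b) * |X|)) := by
  have hb4 := hκ.four_le_of_large hb
  have hb0 : 0 < b := by linarith
  have hK := hκ.K₀_pos
  have hα := hκ.α_pos
  have hα1 := hκ.α_le_one
  have m0 := bump_pos b φ X
  have cw := h.continuous_density (b := b)
  set ε := 1 / (2 * b) with hε
  have ε0 : 0 < ε := by positivity
  have εα : ε ≤ α / 2 := by
    refine le_trans ?_ (hκ.five_div_le hb)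
    rw [hε, div_le_div_iff₀ (by positivity) hb0]
    linarith
  have small : 4 / b ≤ 1 := by rwa [div_le_one hb0]
  have small' : 2 / b ≤ 1 := by rw [div_le_one hb0]; linarith
  set V := 8 / (b * α) * Real.exp (-(ε * |X|)) with hV
  have vle : ∀ t, |Real.exp (-(α * |t|)) * density b φ (X + t)|
      ≤ 2 / b * Real.exp (-(ε * |X|)) * Real.exp (-(α / 2 * |t|)) := by
    intro t
    rw [abs_mul, Real.abs_exp, abs_of_pos (h.density_pos hb0 _)]
    calc _ ≤ Real.exp (-(α * |t|)) * (2 / b * Real.exp (-(ε * |X + t|))) := by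
          gcongr; exact h.density_le_exp hb0 _
      _ = 2 / b * Real.exp (-(α * |t|) + -(ε * |X + t|)) := by rw [Real.exp_add]; ring
      _ ≤ 2 / b * Real.exp (-(ε * |X|) + -(α / 2 * |t|)) := by
          refine mul_le_mul_of_nonneg_left (Real.exp_le_exp.2 ?_) (by positivity)
          have h1 : |X| ≤ |X + t| + |t| := by
            have := abs_sub (X + t) t
            rwa [add_sub_cancel_right] at this
          nlinarith [abs_nonneg t]
      _ = _ := by rw [Real.exp_add]; ring
  have cv : Continuous fun t => Real.exp (-(α * |t|)) * density b φ (X + t) := by fun_prop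
  have ie := (integrable_exp_neg_mul_abs (half_pos hα)).const_mul (2 / b * Real.exp (-(ε * |X|)))
  have iv : Integrable fun t => Real.exp (-(α * |t|)) * density b φ (X + t) :=
    ie.mono' cv.aestronglyMeasurable (Eventually.of_forall vle)
  have hcoef : 2 / b ≤ 8 / (b * α) := by
    rw [div_le_div_iff₀ hb0 (by positivity)]; nlinarith
  have key := hκ.integrable_of_le_dominatingKernel
    (f := fun p => (correctionKernel κ p * density b φ (X - p.1)
      - (interactionDomain ∩ {p | p.2 ≤ 0}).indicator (fun p => Real.exp (-(p.1 + p.2))) p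
        * density b φ X) * density b φ (X + p.2))
    (v := fun t => Real.exp (-(α * |t|)) * density b φ (X + t))
    (C := 14 * (1 + K₀) * bump b φ X) (V := V)
    (by
      have mk := hκ.measurable_correctionKernel
      have mi : Measurable ((interactionDomain ∩ {p : ℝ × ℝ | p.2 ≤ 0}).indicator
          (fun p : ℝ × ℝ => Real.exp (-(p.1 + p.2)))) :=
        Measurable.indicator (by fun_prop) (measurableSet_interactionDomain.inter
          (measurableSet_le measurable_snd measurable_const))
      have mw := cw.measurable
      exact Measurable.aestronglyMeasurable (by fun_prop))
    (by positivity) iv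
    (fun t => by
      refine (vle t).trans ?_
      have : Real.exp (-(α / 2 * |t|)) ≤ 1 :=
        Real.exp_le_one_iff.2 (neg_nonpos.2 (by positivity))
      calc _ ≤ 8 / (b * α) * Real.exp (-(ε * |X|)) * 1 := by gcongr
        _ = V := mul_one _)
    (by
      refine (integral_mono iv.abs ie vle).trans_eq ?_
      rw [integral_const_mul, integral_exp_neg_mul_abs (half_pos hα), hV]
      field_simp
      ring)
    (fun p => by
      have := hκ.abs_correctionKernel_mul_sub_le (u := fun s => density b φ (X - s))
        (u₀ := density b φ X) (A := bump b φ X)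
        (fun s hs => by
          rw [abs_of_pos (h.density_pos hb0 _)]
          refine (h.density_le hb0 _).trans ?_
          calc _ ≤ 1 * (Real.exp (2 * |X - s - X| / b) * bump b φ X) :=
                mul_le_mul small' (h.bump_le_mul_bump hb0 _ _) (bump_pos _ _ _).le one_pos.le
            _ ≤ 1 * (Real.exp (α / 2 * s) * bump b φ X) := by
                rw [sub_sub_cancel_left, abs_neg, abs_of_pos hs]
                have := hκ.exp_two_le_of_large hb hs.le
                gcongr
            _ = _ := by ring)
        ((h.abs_density_le hb4 X).trans (mul_le_of_le_one_left m0.le small))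
        (fun s hs hs1 => by
          have := h.abs_density_add_sub_le hκ hb hfix (r := -s)
            (by rwa [abs_neg, abs_of_pos hs]) X
          rwa [abs_neg, abs_of_pos hs, mul_comm] at this) p
      rw [abs_mul]
      calc _ ≤ (14 * (1 + K₀) * bump b φ X * dominatingKernel (α / 2) p
            * Real.exp (-(α * |p.2|))) * |density b φ (X + p.2)| :=
            mul_le_mul_of_nonneg_right this (abs_nonneg _)
        _ = _ := by rw [abs_mul, Real.abs_exp]; ring)
  obtain ⟨i, e⟩ := key
  have i₁ := (h.integrable_correctionForm hκ hb cw cw (h.abs_density_le hb4)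
    (h.abs_density_le hb4) X).1
  have i₂ : Integrable fun p : ℝ × ℝ => (interactionDomain ∩ {p | p.2 ≤ 0}).indicator
      (fun p => Real.exp (-(p.1 + p.2))) p * density b φ X * density b φ (X + p.2) := by
    refine (i₁.sub i).congr (Eventually.of_forall fun p => ?_)
    simp only [Pi.sub_apply]
    ring
  rw [← h.integral_diagonalKernel_mul_density hb0 i₂, correctionForm, ← integral_sub i₁ i₂]
  simp only [sub_mul] at e
  refine e.trans_eq ?_
  rw [hV]
  ring

/-- The previous estimate divided by the bump, since the form equals b w minus the bump, and b w is
the bump times φ. -/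
theorem exists_abs_sub_le (h : IsGrowthRate φ) (hκ : IsLogKernel κ K₀ α)
    (hb : 400 * formConst K₀ α ≤ b) (hfix : growthMap κ b φ = φ) :
    ∃ C, ∀ X, |φ X - 1 - mass b φ X * φ X / b| ≤ C * Real.exp (-(1 / (2 * b) * |X|)) := by
  have hb0 : 0 < b := by linarith [hκ.four_le_of_large hb]
  refine ⟨14 * (1 + K₀) * ((2 / α + 6) * (8 / (b * α))), fun X => ?_⟩
  have m0 := bump_pos b φ X
  have key := h.abs_correctionForm_sub_le hκ hb hfix X
  have eq := density_equation hb0 hfix X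
  have e : correctionForm κ (density b φ) (density b φ) X - density b φ X * mass b φ X
      = bump b φ X * (φ X - 1 - mass b φ X * φ X / b) := by
    have : b * density b φ X = bump b φ X * φ X := by rw [density]; field_simp
    rw [eq_sub_of_add_eq' eq.symm, this, density]
    ring
  rw [e, abs_mul, abs_of_pos m0] at key
  refine le_of_mul_le_mul_left (key.trans_eq ?_) m0
  ring

theorem exists_abs_sub_one_le (h : IsGrowthRate φ) (hκ : IsLogKernel κ K₀ α)
    (hb : 400 * formConst K₀ α ≤ b) (hfix : growthMap κ b φ = φ) :
    ∃ C, ∀ X ≤ 0, |φ X - 1| ≤ C * Real.exp (1 / (2 * b) * X) := by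
  have hb0 : 0 < b := by linarith [hκ.four_le_of_large hb]
  obtain ⟨C, hC⟩ := h.exists_abs_sub_le hκ hb hfix
  refine ⟨C + 2 / b, fun X hX => ?_⟩
  have h1 := hC X
  rw [abs_of_nonpos hX, mul_neg, neg_neg] at h1
  have hM : mass b φ X ≤ Real.exp (1 / (2 * b) * X) := by
    have hL := h.le_logit_sub hb0 hX
    rw [logit_zero, zero_sub, zero_sub] at hL
    have h2 : mass b φ X ≤ Real.exp (logit b φ X) := by
      rw [mass, Real.sigmoid_def]
      calc _ ≤ (Real.exp (-logit b φ X))⁻¹ := by gcongr; linarith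
        _ = _ := by rw [← Real.exp_neg, neg_neg]
    refine h2.trans (Real.exp_le_exp.2 ?_)
    have : -X / (2 * b) = -(1 / (2 * b) * X) := by ring
    linarith
  have h3 : 0 ≤ mass b φ X * φ X / b :=
    div_nonneg (mul_nonneg (mass_pos _ _ _).le (h.pos X).le) hb0.le
  have h4 : mass b φ X * φ X / b ≤ 2 / b * Real.exp (1 / (2 * b) * X) := by
    calc _ ≤ Real.exp (1 / (2 * b) * X) * 2 / b := by
          have := (h.pos X).le
          gcongr
          exact h.upper X
      _ = _ := by ring
  calc |φ X - 1| = |(φ X - 1 - mass b φ X * φ X / b) + mass b φ X * φ X / b| := by ring_nf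
    _ ≤ _ := (abs_add_le _ _).trans (add_le_add h1 ((abs_of_nonneg h3).trans_le h4))
    _ = _ := by ring

theorem exists_abs_sub_const_le (h : IsGrowthRate φ) (hκ : IsLogKernel κ K₀ α)
    (hb : 400 * formConst K₀ α ≤ b) (hfix : growthMap κ b φ = φ) :
    ∃ C, ∀ X, 0 ≤ X → |φ X - b / (b - 1)| ≤ C * Real.exp (-(1 / (2 * b) * X)) := by
  have hb4 := hκ.four_le_of_large hb
  have hb0 : 0 < b := by linarith
  have hb1 : 0 < b - 1 := by linarith
  obtain ⟨C, hC⟩ := h.exists_abs_sub_le hκ hb hfix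
  refine ⟨b / (b - 1) * (C + 2 / b), fun X hX => ?_⟩
  have h1 := hC X
  rw [abs_of_nonneg hX] at h1
  have hM : 1 - mass b φ X ≤ Real.exp (-(1 / (2 * b) * X)) := by
    have hL := h.le_logit_sub hb0 hX
    rw [logit_zero, sub_zero, sub_zero] at hL
    have h2 : 1 - mass b φ X ≤ Real.exp (-logit b φ X) := by
      rw [mass, ← Real.sigmoid_neg, Real.sigmoid_def, neg_neg]
      calc _ ≤ (Real.exp (logit b φ X))⁻¹ := by gcongr; linarith
        _ = _ := by rw [← Real.exp_neg]
    refine h2.trans (Real.exp_le_exp.2 ?_)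
    have : X / (2 * b) = 1 / (2 * b) * X := by ring
    linarith
  have h3 : 0 ≤ (1 - mass b φ X) * φ X / b :=
    div_nonneg (mul_nonneg (sub_pos.2 (mass_lt_one _ _ _)).le (h.pos X).le) hb0.le
  have h4 : (1 - mass b φ X) * φ X / b ≤ 2 / b * Real.exp (-(1 / (2 * b) * X)) := by
    calc _ ≤ Real.exp (-(1 / (2 * b) * X)) * 2 / b := by
          have := (h.pos X).le
          gcongr
          exact h.upper X
      _ = _ := by ring
  -- The limit solves c = 1 + c/b, the relation with M replaced by 1; the error of that replacement
  -- is (1 - M) φ / b.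
  have e : φ X - b / (b - 1) = b / (b - 1) * ((φ X - 1 - mass b φ X * φ X / b)
      - (1 - mass b φ X) * φ X / b) := by
    field_simp
    ring
  rw [e, abs_mul, abs_of_pos (by positivity), mul_assoc]
  refine mul_le_mul_of_nonneg_left ?_ (by positivity)
  rw [add_mul]
  exact (abs_sub _ _).trans (add_le_add h1 ((abs_of_nonneg h3).trans_le h4))

/-- The deviation φ - c is integrable, so the logit is affine up to a convergent error; mere
convergence of φ would not give a pure exponential for the density. -/
theorem tendsto_logit_sub_atTop (h : IsGrowthRate φ) {c C ε : ℝ} (hε : 0 < ε)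
    (hC : ∀ X, 0 ≤ X → |φ X - c| ≤ C * Real.exp (-(ε * X))) :
    ∃ l, Tendsto (fun X => logit b φ X - c / b * X) atTop (𝓝 l) := by
  have cφ := h.continuous
  have int : IntegrableOn (fun u => φ u - c) (Ioi 0) := by
    refine ((integrableOn_Ioi_exp_neg_mul hε).const_mul C).mono'
      (cφ.sub continuous_const).aestronglyMeasurable ?_
    exact (ae_restrict_iff' measurableSet_Ioi).2 (Eventually.of_forall fun X hX => hC X hX.le)
  have := (intervalIntegral_tendsto_integral_Ioi 0 int tendsto_id).div_const b
  refine ⟨_, this.congr fun X => ?_⟩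
  rw [id, intervalIntegral.integral_sub (cφ.intervalIntegrable _ _)
    (continuous_const.intervalIntegrable _ _), intervalIntegral.integral_const, logit,
    smul_eq_mul]
  ring

theorem tendsto_logit_sub_atBot (h : IsGrowthRate φ) {c C ε : ℝ} (hε : 0 < ε)
    (hC : ∀ X ≤ 0, |φ X - c| ≤ C * Real.exp (ε * X)) :
    ∃ l, Tendsto (fun X => logit b φ X - c / b * X) atBot (𝓝 l) := by
  have cφ := h.continuous
  have int : IntegrableOn (fun u => φ u - c) (Iic 0) := by
    refine ((integrableOn_exp_mul_Iic hε 0).const_mul C).mono'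
      (cφ.sub continuous_const).aestronglyMeasurable ?_
    exact (ae_restrict_iff' measurableSet_Iic).2 (Eventually.of_forall fun X hX => hC X hX)
  have := ((intervalIntegral_tendsto_integral_Iic 0 int tendsto_id).div_const b).neg
  refine ⟨_, this.congr fun X => ?_⟩
  rw [id, intervalIntegral.integral_symm, intervalIntegral.integral_sub
    (cφ.intervalIntegrable _ _) (continuous_const.intervalIntegrable _ _),
    intervalIntegral.integral_const, logit, smul_eq_mul]
  ring

theorem exists_tendsto_density_atTop (h : IsGrowthRate φ) (hκ : IsLogKernel κ K₀ α)
    (hb : 400 * formConst K₀ α ≤ b) (hfix : growthMap κ b φ = φ) :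
    ∃ c, 0 < c ∧ Tendsto (fun X => density b φ X * Real.exp (1 / (b - 1) * X)) atTop (𝓝 c) := by
  have hb4 := hκ.four_le_of_large hb
  have hb0 : 0 < b := by linarith
  have hb1 : 0 < b - 1 := by linarith
  obtain ⟨C, hC⟩ := h.exists_abs_sub_const_le hκ hb hfix
  obtain ⟨l, hl⟩ := h.tendsto_logit_sub_atTop (b := b) (by positivity) hC
  have limφ : Tendsto φ atTop (𝓝 (b / (b - 1))) := by
    rw [tendsto_iff_norm_sub_tendsto_zero]
    refine squeeze_zero' (Eventually.of_forall fun _ => norm_nonneg _)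
      ((eventually_ge_atTop 0).mono hC) ?_
    have : Tendsto (fun X : ℝ => 1 / (2 * b) * X) atTop atTop :=
      tendsto_id.const_mul_atTop (by positivity)
    simpa using (Real.tendsto_exp_neg_atTop_nhds_zero.comp this).const_mul C
  have limM := h.tendsto_mass_atTop hb0
  have lim := (((limM.mul limM).mul (hl.neg.rexp)).mul limφ).div_const b
  refine ⟨_, ?_, lim.congr fun X => ?_⟩
  · positivity
  · have e1 : 1 - mass b φ X = mass b φ X * Real.exp (-logit b φ X) := by
      rw [mass, Real.sigmoid_mul_rexp_neg, Real.sigmoid_neg]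
    have e2 : Real.exp (-(logit b φ X - b / (b - 1) / b * X))
        = Real.exp (-logit b φ X) * Real.exp (1 / (b - 1) * X) := by
      rw [← Real.exp_add]
      congr 1
      field_simp
      ring
    rw [density, bump, e2, e1]
    ring

theorem exists_tendsto_density_atBot (h : IsGrowthRate φ) (hκ : IsLogKernel κ K₀ α)
    (hb : 400 * formConst K₀ α ≤ b) (hfix : growthMap κ b φ = φ) :
    ∃ c, 0 < c ∧ Tendsto (fun X => density b φ X * Real.exp (-(1 / b * X))) atBot (𝓝 c) := by
  have hb4 := hκ.four_le_of_large hb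
  have hb0 : 0 < b := by linarith
  obtain ⟨C, hC⟩ := h.exists_abs_sub_one_le hκ hb hfix
  obtain ⟨l, hl⟩ := h.tendsto_logit_sub_atBot (b := b) (by positivity) hC
  have limφ : Tendsto φ atBot (𝓝 1) := by
    rw [tendsto_iff_norm_sub_tendsto_zero]
    refine squeeze_zero' (Eventually.of_forall fun _ => norm_nonneg _)
      ((eventually_le_atBot 0).mono hC) ?_
    have : Tendsto (fun X : ℝ => 1 / (2 * b) * X) atBot atBot :=
      tendsto_id.const_mul_atBot (by positivity)
    simpa using (Real.tendsto_exp_atBot.comp this).const_mul C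
  have limM := (h.tendsto_mass_atBot hb0).const_sub 1
  have lim := (((limM.mul limM).mul hl.rexp).mul limφ).div_const b
  refine ⟨_, ?_, lim.congr fun X => ?_⟩
  · rw [sub_zero]; positivity
  · have e1 : mass b φ X = (1 - mass b φ X) * Real.exp (logit b φ X) := by
      have := Real.sigmoid_mul_rexp_neg (-logit b φ X)
      rw [neg_neg, Real.sigmoid_neg] at this
      exact this.symm
    have e2 : Real.exp (logit b φ X - 1 / b * X)
        = Real.exp (logit b φ X) * Real.exp (-(1 / b * X)) := by
      rw [← Real.exp_add]; ring_nf
    have e3 : bump b φ X = (1 - mass b φ X) * (1 - mass b φ X) * Real.exp (logit b φ X) := by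
      rw [bump]; linear_combination (1 - mass b φ X) * e1
    rw [density, e3, e2]
    ring

end IsGrowthRate

/-! ### The self-similar equation in logarithmic variables. -/

namespace IsGrowthRate

variable {κ φ : ℝ → ℝ} {K₀ α b : ℝ}

/-- The integrand is a product: s > 0 collects the mass M below X and t > 0 the mass 1 - M above X.
-/
theorem farField_integral (h : IsGrowthRate φ) (hb : 0 < b) (X : ℝ) :
    Integrable (fun p : ℝ × ℝ => (Ioi (0 : ℝ) ×ˢ Ioi (0 : ℝ)).indicator (fun _ => (1 : ℝ)) p
      * density b φ (X - p.1) * density b φ (X + p.2)) ∧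
    ∫ p : ℝ × ℝ, (Ioi (0 : ℝ) ×ˢ Ioi (0 : ℝ)).indicator (fun _ => (1 : ℝ)) p
      * density b φ (X - p.1) * density b φ (X + p.2) = bump b φ X := by
  have iw := h.integrable_density hb
  have split : (fun p : ℝ × ℝ => (Ioi (0 : ℝ) ×ˢ Ioi (0 : ℝ)).indicator (fun _ => (1 : ℝ)) p
      * density b φ (X - p.1) * density b φ (X + p.2)) = fun p : ℝ × ℝ =>
      (Iio X).indicator (density b φ) (X - p.1) * (Ioi X).indicator (density b φ) (X + p.2) := by
    ext ⟨s, t⟩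
    simp only [indicator_apply, mem_prod, mem_Ioi, mem_Iio, sub_lt_self_iff, lt_add_iff_pos_right]
    by_cases hs : 0 < s <;> by_cases ht : 0 < t <;> simp [hs, ht]
  have i₁ : Integrable fun s => (Iio X).indicator (density b φ) (X - s) :=
    (iw.indicator measurableSet_Iio).comp_sub_left X
  have i₂ : Integrable fun t => (Ioi X).indicator (density b φ) (X + t) :=
    (iw.indicator measurableSet_Ioi).comp_add_left X
  rw [split]
  refine ⟨i₁.mul_prod i₂, ?_⟩
  rw [Measure.volume_eq_prod, integral_prod_mul
    (fun s => (Iio X).indicator (density b φ) (X - s))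
    (fun t => (Ioi X).indicator (density b φ) (X + t)),
    integral_sub_left_eq_self (fun s => (Iio X).indicator (density b φ) s) volume X,
    integral_add_left_eq_self (fun t => (Ioi X).indicator (density b φ) t) X,
    integral_indicator measurableSet_Iio, integral_indicator measurableSet_Ioi,
    ← integral_Iic_eq_integral_Iio, h.integral_Iic_density hb, h.integral_Ioi_density hb, bump]

/-- The self-similar equation in logarithmic variables. -/
theorem log_equation (h : IsGrowthRate φ) (hκ : IsLogKernel κ K₀ α)
    (hb : 400 * formConst K₀ α ≤ b) (hfix : growthMap κ b φ = φ) (X : ℝ) :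
    IntegrableOn (fun p : ℝ × ℝ => κ (p.1 + p.2) * density b φ (X - p.1) * density b φ (X + p.2))
      interactionDomain ∧
    ∫ p in interactionDomain, κ (p.1 + p.2) * density b φ (X - p.1) * density b φ (X + p.2)
      = b * density b φ X := by
  have hb4 := hκ.four_le_of_large hb
  have hb0 : 0 < b := by linarith
  have cw := h.continuous_density (b := b)
  obtain ⟨i₁, e₁⟩ := h.farField_integral hb0 X
  have i₂ := (h.integrable_correctionForm hκ hb cw cw (h.abs_density_le hb4)
    (h.abs_density_le hb4) X).1
  have split : interactionDomain.indicator (fun p : ℝ × ℝ => κ (p.1 + p.2)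
      * density b φ (X - p.1) * density b φ (X + p.2)) = fun p =>
      (Ioi (0 : ℝ) ×ˢ Ioi (0 : ℝ)).indicator (fun _ => (1 : ℝ)) p
      * density b φ (X - p.1) * density b φ (X + p.2)
      + correctionKernel κ p * density b φ (X - p.1) * density b φ (X + p.2) := by
    ext p
    rw [correctionKernel]
    by_cases hp : p ∈ interactionDomain
    · rw [indicator_of_mem hp, indicator_of_mem hp]; ring
    · rw [indicator_of_notMem hp, indicator_of_notMem hp]; ring
  rw [← integrable_indicator_iff measurableSet_interactionDomain,
    ← integral_indicator measurableSet_interactionDomain, split]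
  refine ⟨i₁.add i₂, ?_⟩
  rw [integral_add i₁ i₂, e₁, density_equation hb0 hfix, correctionForm]

end IsGrowthRate

/-! ### Return to the original variables. -/

/-- The change of variables from `(s, t)` to `(y, z)`. -/
noncomputable def expCoords (x : ℝ) (p : ℝ × ℝ) : ℝ × ℝ :=
  (x * Real.exp (-p.1), x * Real.exp p.2)

noncomputable def expCoordsDeriv (x : ℝ) (p : ℝ × ℝ) : ℝ × ℝ →L[ℝ] ℝ × ℝ :=
  (ContinuousLinearMap.toSpanSingleton ℝ (-(x * Real.exp (-p.1)))).prodMap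
    (ContinuousLinearMap.toSpanSingleton ℝ (x * Real.exp p.2))

theorem hasFDerivAt_expCoords (x : ℝ) (p : ℝ × ℝ) :
    HasFDerivAt (expCoords x) (expCoordsDeriv x p) p := by
  have h1 : HasDerivAt (fun s => x * Real.exp (-s)) (-(x * Real.exp (-p.1))) p.1 := by
    refine (((hasDerivAt_id p.1).neg.exp).const_mul x).congr_deriv ?_
    simp
  have h2 : HasDerivAt (fun t => x * Real.exp t) (x * Real.exp p.2) p.2 :=
    (Real.hasDerivAt_exp p.2).const_mul x
  exact h1.hasFDerivAt.prodMap p h2.hasFDerivAt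

theorem abs_det_expCoordsDeriv {x : ℝ} (hx : 0 < x) (p : ℝ × ℝ) :
    |(expCoordsDeriv x p).det| = x * Real.exp (-p.1) * (x * Real.exp p.2) := by
  have h1 := ContinuousLinearMap.det_toSpanSingleton (-(x * Real.exp (-p.1)))
  have h2 := ContinuousLinearMap.det_toSpanSingleton (x * Real.exp p.2)
  have : (expCoordsDeriv x p).det = -(x * Real.exp (-p.1)) * (x * Real.exp p.2) := by
    rw [ContinuousLinearMap.det] at h1 h2 ⊢
    rw [expCoordsDeriv, ContinuousLinearMap.coe_prodMap, LinearMap.det_prodMap, h1, h2]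
  rw [this, neg_mul, abs_neg, abs_of_pos (by positivity)]

theorem injOn_expCoords {x : ℝ} (hx : 0 < x) (s : Set (ℝ × ℝ)) : InjOn (expCoords x) s := by
  rintro ⟨a, b⟩ - ⟨c, d⟩ - h
  simp only [expCoords, Prod.mk.injEq, mul_right_inj' hx.ne', Real.exp_eq_exp, neg_inj] at h
  exact Prod.ext h.1 h.2

theorem image_expCoords {x : ℝ} (hx : 0 < x) :
    expCoords x '' interactionDomain = {p : ℝ × ℝ | 0 < p.1 ∧ p.1 < x ∧ x - p.1 < p.2} := by
  ext ⟨y, z⟩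
  constructor
  · rintro ⟨⟨s, t⟩, ⟨hs, hd⟩, h⟩
    simp only [expCoords, Prod.mk.injEq] at h hs hd
    obtain ⟨rfl, rfl⟩ := h
    refine ⟨by positivity, ?_, ?_⟩
    · have : Real.exp (-s) < 1 := by simpa using hs
      simp only
      nlinarith
    · simp only
      nlinarith
  · rintro ⟨hy, hyx, hz⟩
    simp only at hy hyx hz
    have hz0 : 0 < z := by linarith
    have ey : Real.exp (Real.log (y / x)) = y / x := Real.exp_log (by positivity)
    have ez : Real.exp (Real.log (z / x)) = z / x := Real.exp_log (by positivity)
    refine ⟨(-Real.log (y / x), Real.log (z / x)), ⟨?_, ?_⟩, ?_⟩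
    · simp only [Left.neg_pos_iff]
      exact Real.log_neg (by positivity) (by rwa [div_lt_one hx])
    · simp only [neg_neg, ey, ez]
      rw [← add_div, lt_div_iff₀ hx]
      linarith
    · simp only [expCoords, neg_neg, ey, ez]
      rw [mul_div_cancel₀ _ hx.ne', mul_div_cancel₀ _ hx.ne']

/-- The Jacobian y z cancels the two denominators in g, and K(y, z)/z = K(y/z, 1) by homogeneity. -/
theorem expCoords_integrand {K : ℝ → ℝ → ℝ} (hK : IsCoagulationKernel K) {x : ℝ} (hx : 0 < x)
    (w : ℝ → ℝ) (p : ℝ × ℝ) :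
    |(expCoordsDeriv x p).det| • (K (expCoords x p).1 (expCoords x p).2 / (expCoords x p).2
      * (w (Real.log (expCoords x p).1) / (expCoords x p).1)
      * (w (Real.log (expCoords x p).2) / (expCoords x p).2))
      = K (Real.exp (-(p.1 + p.2))) 1 * w (Real.log x - p.1) * w (Real.log x + p.2) := by
  have ly : Real.log (x * Real.exp (-p.1)) = Real.log x - p.1 := by
    rw [Real.log_mul hx.ne' (Real.exp_pos _).ne', Real.log_exp]; ring
  have lz : Real.log (x * Real.exp p.2) = Real.log x + p.2 := by
    rw [Real.log_mul hx.ne' (Real.exp_pos _).ne', Real.log_exp]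
  have y0 : 0 < x * Real.exp (-p.1) := by positivity
  have z0 : 0 < x * Real.exp p.2 := by positivity
  have eK : K (x * Real.exp (-p.1)) (x * Real.exp p.2)
      = x * Real.exp p.2 * K (Real.exp (-(p.1 + p.2))) 1 := by
    rw [← hK.homogeneous _ _ _ z0 (Real.exp_pos _) one_pos, mul_one]
    congr 1
    rw [mul_assoc, ← Real.exp_add]
    ring_nf
  rw [abs_det_expCoordsDeriv hx, smul_eq_mul]
  simp only [expCoords, ly, lz, eK]
  field_simp

theorem IsCoagulationKernel.isSelfSimilarSolution_of_log_equation {K : ℝ → ℝ → ℝ} (hK : IsCoagulationKernel K)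
    {b : ℝ} {w : ℝ → ℝ}
    (hw : ∀ X, IntegrableOn (fun p : ℝ × ℝ => K (Real.exp (-(p.1 + p.2))) 1 * w (X - p.1)
      * w (X + p.2)) interactionDomain ∧
      ∫ p in interactionDomain, K (Real.exp (-(p.1 + p.2))) 1 * w (X - p.1) * w (X + p.2)
        = b * w X) :
    IsSelfSimilarSolution K b fun x => w (Real.log x) / x := by
  have int : ∀ x : ℝ, 0 < x → IntegrableOn (fun p : ℝ × ℝ =>
      K p.1 p.2 / p.2 * (w (Real.log p.1) / p.1) * (w (Real.log p.2) / p.2))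
      {p : ℝ × ℝ | 0 < p.1 ∧ p.1 < x ∧ x - p.1 < p.2} := by
    intro x hx
    rw [← image_expCoords hx, integrableOn_image_iff_integrableOn_abs_det_fderiv_smul volume
      measurableSet_interactionDomain
      (fun p _ => (hasFDerivAt_expCoords x p).hasFDerivWithinAt) (injOn_expCoords hx _)]
    simp only [expCoords_integrand hK hx]
    exact (hw _).1
  refine ⟨int, fun x hx => ?_⟩
  have meas : MeasurableSet {p : ℝ × ℝ | 0 < p.1 ∧ p.1 < x ∧ x - p.1 < p.2} :=
    (measurableSet_lt measurable_const measurable_fst).inter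
      ((measurableSet_lt measurable_fst measurable_const).inter
        (measurableSet_lt (measurable_const.sub measurable_fst) measurable_snd))
  have eq : ∫ p in {p : ℝ × ℝ | 0 < p.1 ∧ p.1 < x ∧ x - p.1 < p.2},
      K p.1 p.2 / p.2 * (w (Real.log p.1) / p.1) * (w (Real.log p.2) / p.2)
      = b * w (Real.log x) := by
    rw [← image_expCoords hx, integral_image_eq_integral_abs_det_fderiv_smul volume
      measurableSet_interactionDomain
      (fun p _ => (hasFDerivAt_expCoords x p).hasFDerivWithinAt) (injOn_expCoords hx _)]
    simp only [expCoords_integrand hK hx]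
    exact (hw _).2
  have lhs : b * x * (w (Real.log x) / x) = b * w (Real.log x) := by field_simp
  -- Absolute integrability allows Fubini; slices with y outside (0, x) are empty.
  rw [lhs, ← eq, ← integral_indicator meas, Measure.volume_eq_prod, integral_prod _
    ((integrable_indicator_iff meas).2 (int x hx)), ← integral_indicator measurableSet_Ioo]
  congr 1
  ext y
  by_cases hy : y ∈ Ioo 0 x
  · rw [indicator_of_mem hy, ← integral_indicator measurableSet_Ioi]
    congr 1
    ext z
    by_cases hz : z ∈ Ioi (x - y)
    · rw [indicator_of_mem hz, indicator_of_mem (show (y, z) ∈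
        {p : ℝ × ℝ | 0 < p.1 ∧ p.1 < x ∧ x - p.1 < p.2} from ⟨hy.1, hy.2, hz⟩)]
    · rw [indicator_of_notMem hz, indicator_of_notMem fun h => hz h.2.2]
  · rw [indicator_of_notMem hy]
    refine integral_eq_zero_of_ae (Eventually.of_forall fun z => ?_)
    exact indicator_of_notMem (fun h => hy ⟨h.1, h.2.1⟩) _

theorem integral_Ioi_comp_log_div {w : ℝ → ℝ} (hw : Integrable w) :
    IntegrableOn (fun x => w (Real.log x) / x) (Ioi 0) ∧
      ∫ x in Ioi (0 : ℝ), w (Real.log x) / x = ∫ X, w X := by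
  have image : Real.exp '' univ = Ioi 0 := by rw [image_univ, Real.range_exp]
  have e : ∀ X : ℝ, |Real.exp X| • (w (Real.log (Real.exp X)) / Real.exp X) = w X := by
    intro X
    rw [Real.log_exp, Real.abs_exp, smul_eq_mul, mul_div_cancel₀ _ (Real.exp_pos X).ne']
  constructor
  · rw [← image, integrableOn_image_iff_integrableOn_abs_deriv_smul MeasurableSet.univ
      (fun X _ => (Real.hasDerivAt_exp X).hasDerivWithinAt) Real.exp_injective.injOn]
    simpa only [e, integrableOn_univ] using hw
  · rw [← image, integral_image_eq_integral_abs_deriv_smul MeasurableSet.univ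
      (fun X _ => (Real.hasDerivAt_exp X).hasDerivWithinAt) Real.exp_injective.injOn]
    simp only [e, setIntegral_univ]

/-- Exponential asymptotics in the logarithmic variable are power laws. -/
theorem isEquivalent_comp_log_div {w : ℝ → ℝ} {l l' : Filter ℝ} {c m a : ℝ} (hc : 0 < c)
    (hl : Tendsto Real.log l l') (hpos : ∀ᶠ x in l, 0 < x)
    (hw : Tendsto (fun X => w X * Real.exp (m * X)) l' (𝓝 c)) (ha : a = -(1 + m)) :
    (fun x => w (Real.log x) / x) ~[l] fun x => c * x ^ a := by
  refine isEquivalent_of_tendsto_one ?_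
  have := (hw.comp hl).div_const c
  rw [div_self hc.ne'] at this
  refine this.congr' ?_
  filter_upwards [hpos] with x hx
  have e : Real.exp (m * Real.log x) * (x * x ^ a) = 1 := by
    have : x * x ^ a = x ^ (1 + a) := by rw [Real.rpow_add hx, Real.rpow_one]
    rw [this, mul_comm m, ← Real.rpow_def_of_pos hx, ← Real.rpow_add hx, ha]
    simp
  have : 0 < x ^ a := Real.rpow_pos_of_pos hx a
  simp only [Function.comp_apply, Pi.div_apply]
  rw [div_div, div_eq_div_iff hc.ne' (by positivity)]
  linear_combination c * w (Real.log x) * e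

/-! ### Assembly of the theorem. -/

theorem theorem1p1 (K : ℝ → ℝ → ℝ) (hK : IsCoagulationKernel K) :
    ∃ ρstar : ℝ, 0 < ρstar ∧ ∀ ρ ∈ Ioo 0 ρstar, ∀ b : ℝ, b = (1 + ρ) / ρ →
      ∃ g : ℝ → ℝ,
        ContDiffOn ℝ 1 g (Ioi 0) ∧
        (∀ x : ℝ, 0 < x → 0 < g x) ∧
        IsSelfSimilarSolution K b g ∧
        IntegrableOn g (Ioi 0) ∧ ∫ x in Ioi (0 : ℝ), g x = 1 ∧
        (∃ c₀ : ℝ, 0 < c₀ ∧ g ~[𝓝[>] 0] fun x => c₀ * x ^ (-(1 / (1 + ρ)))) ∧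
        (∃ c₁ : ℝ, 0 < c₁ ∧ g ~[atTop] fun x => c₁ * x ^ (-(1 + ρ))) := by
  obtain ⟨K₀, α, hκ⟩ := hK.isLogKernel
  have hF := hκ.formConst_pos
  -- For smaller ρ, b = 1 + 1/ρ exceeds 1/ρ and hence the threshold on b.
  refine ⟨1 / (400 * formConst K₀ α), by positivity, ?_⟩
  rintro ρ ⟨hρ, hρ'⟩ b rfl
  have hb : 400 * formConst K₀ α ≤ (1 + ρ) / ρ := by
    rw [lt_div_iff₀ (by positivity)] at hρ'
    rw [le_div_iff₀ hρ]
    linarith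
  set b := (1 + ρ) / ρ with hbdef
  have hb0 : 0 < b := by positivity
  obtain ⟨φ, h, hfix⟩ := hκ.exists_fixedPoint hb
  have hcd := h.contDiff_density hκ hb hfix
  obtain ⟨hint, hone⟩ := integral_Ioi_comp_log_div (h.integrable_density hb0)
  obtain ⟨c₀, hc₀, hlim₀⟩ := h.exists_tendsto_density_atBot hκ hb hfix
  obtain ⟨c₁, hc₁, hlim₁⟩ := h.exists_tendsto_density_atTop hκ hb hfix
  refine ⟨fun x => density b φ (Real.log x) / x, ?_, ?_, ?_, hint, ?_, ⟨c₀, hc₀, ?_⟩,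
    ⟨c₁, hc₁, ?_⟩⟩
  · refine ContDiffOn.div (hcd.comp_contDiffOn (Real.contDiffOn_log.mono ?_)) contDiffOn_id ?_
    · exact fun x hx => ne_of_gt hx
    · exact fun x hx => ne_of_gt hx
  · exact fun x hx => div_pos (h.density_pos hb0 _) hx
  · exact hK.isSelfSimilarSolution_of_log_equation fun X => h.log_equation hκ hb hfix X
  · rw [hone, h.integral_density hb0]
  -- The exponent is 1/b - 1 = -1/(1 + ρ).
  · refine isEquivalent_comp_log_div (m := -(1 / b)) hc₀ Real.tendsto_log_nhdsGT_zero
      self_mem_nhdsWithin (by simpa only [neg_mul] using hlim₀) ?_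
    rw [hbdef]
    field_simp
    ring
  -- Here 1/(b - 1) = ρ.
  · refine isEquivalent_comp_log_div (m := 1 / (b - 1)) hc₁ Real.tendsto_log_atTop
      (eventually_gt_atTop 0) hlim₁ ?_
    rw [hbdef]
    field_simp
    ring
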